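/- Let $\sigma,\gamma>0$, $\xi=\sqrt2\,\sigma/\gamma$ and $0<\varepsilon<1$. For $n\ge 1$ consider the problem of deciding, from one observation $\mathbf y\in\mathbb R^n$, between the hypotheses $H_0$: $\mathbf y$ is circular (IID) Gaussian $\mathcal N(0,\sigma^2)$, with density $$p_G(\mathbf y)=\frac{1}{(2\pi\sigma^2)^{n/2}}\,e^{-\|\mathbf y\|^2/(2\sigma^2)},$$ and $H_1$: $\mathbf y$ is circular (isotropic) Cauchy $\mathcal C(0,\gamma)$, with density $$p_C(\mathbf y)=\frac{\Gamma\left(\frac{n+1}{2}\right)}{\pi^{\frac{n+1}{2}}\gamma^n}\,\frac{1}{\left(1+\|\mathbf y\|^2/\gamma^2\right)^{\frac{n+1}{2}}}.$$ The likelihood ratio test (LRT) with threshold $\eta>0$ decides on $H_0$ if $p_G(\mathbf y)/p_C(\mathbf y)\ge\eta$ and on $H_1$ otherwise. For any detector, $P_F$ is the probability of deciding on $H_1$ when $H_0$ holds, and $P_D$ is the probability of deciding on $H_1$ when $H_1$ holds. Let $Q(x)=\frac1{\sqrt{2\pi}}\int_x^\infty e^{-t^2/2}\,dt$. Case 1.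 For every $n\ge1$ there is a threshold $\eta>0$ for which the LRT has $P_F=\varepsilon$, and any such LRT is optimal: it has the largest $P_D$ among all detectors with $P_F\le\varepsilon$. If for all large $n$ the threshold is chosen so that $P_F=\varepsilon$, then as $n\to\infty$ $$1-P_D\;\sim\;\sqrt{\frac2\pi}\,\frac2\xi\,e^{-1/\xi^2}\,Q^{-1}\!\left(\frac\varepsilon2\right)\frac1{\sqrt n}.$$ Case 2. For every $n\ge1$ there is a threshold $\eta>0$ for which the LRT has $1-P_D=\varepsilon$, and any such LRT is optimal: it has the smallest $P_F$ among all detectors with $1-P_D\le\varepsilon$. There are constants $\kappa_1,\kappa_2,\kappa_3,\kappa_4>0$, not depending on $n$, such that for every $n\ge1$ the LRT with $1-P_D=\varepsilon$ satisfies $$\frac{\kappa_1e^{-\kappa_2n}}{\sqrt n}\;\le\;P_F\;\le\;\frac{\kappa_3e^{-\kappa_4n}}{\sqrt n}.$$ -/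

import Mathlib

open MeasureTheory ProbabilityTheory Filter

noncomputable section

namespace GaussCauchy

/-- The space of observation vectors `y = (y₁, …, yₙ)`, with the Euclidean norm. -/
abbrev Obs (n : ℕ) : Type := EuclideanSpace ℝ (Fin n)

/-- Density of `n` IID centred Gaussian variables of variance `σ ^ 2`
(the circular Gaussian law on `ℝⁿ`). -/
def gaussianDensity (σ : ℝ) (n : ℕ) (y : Obs n) : ℝ :=
  1 / (2 * Real.pi * σ ^ 2) ^ ((n : ℝ) / 2) * Real.exp (-‖y‖ ^ 2 / (2 * σ ^ 2))

/-- Density of the centred isotropic Cauchy law on `ℝⁿ` with scale parameter `γ`. -/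
def cauchyDensity (γ : ℝ) (n : ℕ) (y : Obs n) : ℝ :=
  Real.Gamma (((n : ℝ) + 1) / 2) / (Real.pi ^ (((n : ℝ) + 1) / 2) * γ ^ n)
    * (1 / (1 + ‖y‖ ^ 2 / γ ^ 2) ^ (((n : ℝ) + 1) / 2))

/-- Law of the observations under the null hypothesis `H₀` (Gaussian). -/
def gaussianLaw (σ : ℝ) (n : ℕ) : Measure (Obs n) :=
  volume.withDensity fun y => ENNReal.ofReal (gaussianDensity σ n y)

/-- Law of the observations under the alternative hypothesis `H₁` (Cauchy). -/
def cauchyLaw (γ : ℝ) (n : ℕ) : Measure (Obs n) :=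
  volume.withDensity fun y => ENNReal.ofReal (cauchyDensity γ n y)

/-- A detector is given by the set `A` of observations for which it decides on `H₀`.
Its probability of false alarm is the probability of deciding on `H₁` under `H₀`. -/
def falseAlarm (σ : ℝ) (n : ℕ) (A : Set (Obs n)) : ℝ :=
  (gaussianLaw σ n).real Aᶜ

/-- The probability of detection of the detector that decides on `H₀` exactly on `A`:
the probability of deciding on `H₁` under `H₁`. -/
def detection (γ : ℝ) (n : ℕ) (A : Set (Obs n)) : ℝ :=
  (cauchyLaw γ n).real Aᶜ

/-- The likelihood ratio test with threshold `η`: it decides on the Gaussian hypothesis `H₀`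
exactly when the ratio of the Gaussian to the Cauchy density is at least `η`. -/
def lrt (σ γ : ℝ) (n : ℕ) (η : ℝ) : Set (Obs n) :=
  {y | η ≤ gaussianDensity σ n y / cauchyDensity γ n y}

/-- Neyman-Pearson optimality at false alarm level `ε`: the detector satisfies `P_F ≤ ε` and has
the largest `P_D` among all detectors with `P_F ≤ ε`. -/
def OptimalGivenFalseAlarm (σ γ : ℝ) (n : ℕ) (ε : ℝ) (A : Set (Obs n)) : Prop :=
  MeasurableSet A ∧ falseAlarm σ n A ≤ ε ∧
    ∀ B : Set (Obs n), MeasurableSet B → falseAlarm σ n B ≤ ε →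
      detection γ n B ≤ detection γ n A

/-- Neyman-Pearson optimality at miss level `ε`: the detector satisfies `1 - P_D ≤ ε` and has
the smallest `P_F` among all detectors with `1 - P_D ≤ ε`. -/
def OptimalGivenMiss (σ γ : ℝ) (n : ℕ) (ε : ℝ) (A : Set (Obs n)) : Prop :=
  MeasurableSet A ∧ 1 - detection γ n A ≤ ε ∧
    ∀ B : Set (Obs n), MeasurableSet B → 1 - detection γ n B ≤ ε →
      falseAlarm σ n A ≤ falseAlarm σ n B

/-- The standard Gaussian tail function `Q`. -/
def gaussianQ (x : ℝ) : ℝ := (gaussianReal 0 1).real (Set.Ioi x)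

/-- The inverse of `Q`; it is only meaningful on the range `(0, 1)` of `Q`. -/
def gaussianQInv : ℝ → ℝ := Function.invFun gaussianQ

end GaussCauchy

end

noncomputable section

namespace GaussCauchy

/-! Optimality is Neyman-Pearson: the LRT decides on $H_1$ exactly where $p_G-\eta p_C<0$, so its
rejection region minimises the integral of that function (`neyman_pearson`). Exact levels are
attained because the log ratio is strictly concave in $\|y\|^2$; its level sets are finite unions of
spheres, hence null, and the ratio has a continuous cdf under either law (`exists_threshold`).

Case 1. Under $H_0$ the rescaled norm $\sqrt2(\|y\|/\sigma-\sqrt n)$ has a density converging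
pointwise, hence by Scheffé in $L^1$, to the standard normal density (`tendsto_scaledDensity`). The
ratio divided by its value $c_n$ at $\|y\|=\sigma\sqrt n$ tends to $e^{-x^2/2}$
(`tendsto_scaledRatio`). So the acceptance region tends to $[-q,q]$ with $Q(q)=\varepsilon/2$
(`tendsto_threshold`). Integrating the reciprocal ratio against the Gaussian law gives
$c_n(1-P_D)\to\int_{-q}^q e^{x^2/2}\varphi(x)\,dx=2q/\sqrt{2\pi}$. Stirling gives $c_n\sim\sqrt
n\,(\xi/2)e^{1/\xi^2}$ (`tendsto_ratioProfile_div_sqrt`), and the claim is the quotient of these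
limits.

Case 2. The upper bound compares the LRT with the detector that accepts $H_0$ on a thin shell around
radius $\sigma\sqrt n$. The Cauchy mass of a shell of width proportional to $\sqrt n$ is bounded
uniformly in $n$ by a multiple of its relative width, so a fixed thin shell has miss at most
$\varepsilon$, while its false alarm decays exponentially by Chernoff. For the lower bound, a fixed
share of the Cauchy mass of any rejection region lies in $m\sqrt n\le\|y\|\le M\sqrt n$, where
$p_G\ge e^{\kappa n}p_C$. The factor $1/\sqrt n$ costs only a change of constants. -/

/-! ### The two densities and their normalisation -/

lemma gaussianDensity_pos {σ : ℝ} (hσ : 0 < σ) (n : ℕ) (y : Obs n) :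
    0 < gaussianDensity σ n y := by
  unfold gaussianDensity
  have := Real.pi_pos
  positivity

lemma cauchyDensity_pos {γ : ℝ} (hγ : 0 < γ) (n : ℕ) (y : Obs n) :
    0 < cauchyDensity γ n y := by
  unfold cauchyDensity
  have := Real.pi_pos
  have := Real.Gamma_pos_of_pos (s := ((n : ℝ) + 1) / 2) (by positivity)
  positivity

lemma measurable_gaussianDensity (σ : ℝ) (n : ℕ) : Measurable (gaussianDensity σ n) := by
  unfold gaussianDensity
  fun_prop

lemma measurable_cauchyDensity (γ : ℝ) (n : ℕ) : Measurable (cauchyDensity γ n) := by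
  unfold cauchyDensity
  fun_prop

lemma integral_exp_neg_mul_sq {b : ℝ} (hb : 0 < b) (n : ℕ) :
    ∫ y : Obs n, Real.exp (-b * ‖y‖ ^ 2) = (Real.pi / b) ^ ((n : ℝ) / 2) := by
  have := GaussianFourier.integral_rexp_neg_mul_sq_norm (V := Obs n) hb
  simpa using this

/-- A non-integrable function would have Bochner integral 0, but the known value is positive. -/
lemma integrable_exp_neg_mul_sq {b : ℝ} (hb : 0 < b) (n : ℕ) :
    Integrable fun y : Obs n => Real.exp (-b * ‖y‖ ^ 2) := by
  by_contra h
  have h1 := integral_exp_neg_mul_sq hb n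
  rw [integral_undef h] at h1
  have : 0 < (Real.pi / b) ^ ((n : ℝ) / 2) := by
    have := Real.pi_pos
    positivity
  linarith

lemma gaussianDensity_eq (σ : ℝ) (n : ℕ) : gaussianDensity σ n = fun y : Obs n =>
    1 / (2 * Real.pi * σ ^ 2) ^ ((n : ℝ) / 2) * Real.exp (-(1 / (2 * σ ^ 2)) * ‖y‖ ^ 2) := by
  funext y
  unfold gaussianDensity
  congr 2
  ring

lemma integrable_gaussianDensity {σ : ℝ} (hσ : 0 < σ) (n : ℕ) :
    Integrable (gaussianDensity σ n) := by
  rw [gaussianDensity_eq]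
  exact (integrable_exp_neg_mul_sq (by positivity) n).const_mul _

lemma integral_gaussianDensity {σ : ℝ} (hσ : 0 < σ) (n : ℕ) :
    ∫ y, gaussianDensity σ n y = 1 := by
  have := Real.pi_pos
  rw [gaussianDensity_eq, integral_const_mul, integral_exp_neg_mul_sq (by positivity)]
  have : Real.pi / (1 / (2 * σ ^ 2)) = 2 * Real.pi * σ ^ 2 := by field_simp
  rw [this, one_div, inv_mul_cancel₀]
  positivity

lemma ofReal_gamma_mul_rpow {a r : ℝ} (ha : 0 < a) (hr : 0 < r) :
    ∫⁻ s in Set.Ioi (0 : ℝ), ENNReal.ofReal (s ^ (a - 1) * Real.exp (-(r * s))) =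
      ENNReal.ofReal ((1 / r) ^ a * Real.Gamma a) := by
  have h := Real.integral_rpow_mul_exp_neg_mul_Ioi ha hr
  have hpos : 0 < (1 / r) ^ a * Real.Gamma a := by
    have := Real.Gamma_pos_of_pos ha
    positivity
  rw [← h, ofReal_integral_eq_lintegral_ofReal]
  · exact Integrable.of_integral_ne_zero (by rw [h]; exact hpos.ne')
  · refine (ae_restrict_iff' measurableSet_Ioi).2 (ae_of_all _ fun s hs => ?_)
    have : 0 < s := hs
    simp only [Pi.zero_apply]
    positivity

/-- The isotropic Cauchy density is a mixture of Gaussian densities. -/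
lemma ofReal_cauchyDensity {γ : ℝ} (hγ : 0 < γ) (n : ℕ) (y : Obs n) :
    ENNReal.ofReal (cauchyDensity γ n y) =
      ENNReal.ofReal (1 / (Real.pi ^ (((n : ℝ) + 1) / 2) * γ ^ n)) *
        ∫⁻ s in Set.Ioi (0 : ℝ), ENNReal.ofReal
          (s ^ (((n : ℝ) + 1) / 2 - 1) * Real.exp (-((1 + ‖y‖ ^ 2 / γ ^ 2) * s))) := by
  have := Real.pi_pos
  rw [ofReal_gamma_mul_rpow (by positivity) (by positivity), ← ENNReal.ofReal_mul (by positivity)]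
  congr 1
  unfold cauchyDensity
  rw [Real.div_rpow (by positivity) (by positivity), Real.one_rpow]
  ring

/-- By Tonelli on the Gaussian mixture, the integral over $y$ is Gaussian and leaves the Gamma
integral for $\Gamma(1/2)=\sqrt\pi$. -/
lemma lintegral_cauchyDensity {γ : ℝ} (hγ : 0 < γ) (n : ℕ) :
    ∫⁻ y, ENNReal.ofReal (cauchyDensity γ n y) = 1 := by
  have hpi := Real.pi_pos
  simp_rw [ofReal_cauchyDensity hγ]
  rw [lintegral_const_mul' _ _ ENNReal.ofReal_ne_top, lintegral_lintegral_swap]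
  swap
  · exact Measurable.aemeasurable (by fun_prop)
  have hinner : ∀ s ∈ Set.Ioi (0 : ℝ),
      ∫⁻ y : Obs n, ENNReal.ofReal
        (s ^ (((n : ℝ) + 1) / 2 - 1) * Real.exp (-((1 + ‖y‖ ^ 2 / γ ^ 2) * s))) =
      ENNReal.ofReal ((Real.pi * γ ^ 2) ^ ((n : ℝ) / 2)) *
        ENNReal.ofReal (s ^ ((1 / 2 : ℝ) - 1) * Real.exp (-(1 * s))) := by
    intro s hs
    have hs : 0 < s := hs
    have hfun : (fun y : Obs n => s ^ (((n : ℝ) + 1) / 2 - 1) *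
        Real.exp (-((1 + ‖y‖ ^ 2 / γ ^ 2) * s))) = fun y : Obs n =>
        (s ^ (((n : ℝ) + 1) / 2 - 1) * Real.exp (-s)) * Real.exp (-(s / γ ^ 2) * ‖y‖ ^ 2) := by
      funext y
      rw [mul_assoc, ← Real.exp_add]
      congr 2
      ring
    have hint : Integrable fun y : Obs n =>
        (s ^ (((n : ℝ) + 1) / 2 - 1) * Real.exp (-s)) * Real.exp (-(s / γ ^ 2) * ‖y‖ ^ 2) :=
      (integrable_exp_neg_mul_sq (by positivity) n).const_mul _
    rw [← ofReal_integral_eq_lintegral_ofReal (by rw [hfun]; exact hint)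
      (ae_of_all _ fun y => by simp only [Pi.zero_apply]; positivity), hfun, integral_const_mul,
      integral_exp_neg_mul_sq (by positivity), ← ENNReal.ofReal_mul (by positivity)]
    congr 1
    have h1 : Real.pi / (s / γ ^ 2) = Real.pi * γ ^ 2 / s := by field_simp
    rw [h1, Real.div_rpow (by positivity) hs.le,
      show ((n : ℝ) + 1) / 2 - 1 = ((1 / 2 : ℝ) - 1) + (n : ℝ) / 2 by ring, Real.rpow_add hs]
    have : 0 < s ^ ((n : ℝ) / 2) := by positivity
    field_simp
  rw [setLIntegral_congr_fun measurableSet_Ioi hinner,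
    lintegral_const_mul' _ _ ENNReal.ofReal_ne_top,
    ofReal_gamma_mul_rpow (by norm_num) one_pos, ← ENNReal.ofReal_mul (by positivity),
    ← ENNReal.ofReal_mul (by positivity), Real.Gamma_one_half_eq]
  rw [ENNReal.ofReal_eq_one, add_div, Real.rpow_add hpi, Real.mul_rpow hpi.le (by positivity),
    ← Real.rpow_natCast γ 2, ← Real.rpow_mul hγ.le, ← Real.sqrt_eq_rpow]
  have : ((2 : ℕ) : ℝ) * ((n : ℝ) / 2) = n := by push_cast; ring
  rw [this, Real.rpow_natCast]
  have : 0 < Real.pi ^ ((n : ℝ) / 2) := by positivity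
  field_simp
  simp

lemma integrable_cauchyDensity {γ : ℝ} (hγ : 0 < γ) (n : ℕ) :
    Integrable (cauchyDensity γ n) := by
  refine ⟨(measurable_cauchyDensity γ n).aestronglyMeasurable, ?_⟩
  rw [hasFiniteIntegral_iff_ofReal (ae_of_all _ fun y => (cauchyDensity_pos hγ n y).le),
    lintegral_cauchyDensity hγ]
  exact ENNReal.one_lt_top

lemma isProbabilityMeasure_gaussianLaw {σ : ℝ} (hσ : 0 < σ) (n : ℕ) :
    IsProbabilityMeasure (gaussianLaw σ n) := by
  refine ⟨?_⟩
  rw [gaussianLaw, withDensity_apply _ MeasurableSet.univ, Measure.restrict_univ,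
    ← ofReal_integral_eq_lintegral_ofReal (integrable_gaussianDensity hσ n)
      (ae_of_all _ fun y => (gaussianDensity_pos hσ n y).le), integral_gaussianDensity hσ]
  simp

lemma isProbabilityMeasure_cauchyLaw {γ : ℝ} (hγ : 0 < γ) (n : ℕ) :
    IsProbabilityMeasure (cauchyLaw γ n) := by
  refine ⟨?_⟩
  rw [cauchyLaw, withDensity_apply _ MeasurableSet.univ, Measure.restrict_univ,
    lintegral_cauchyDensity hγ]

lemma real_withDensity_ofReal {α : Type*} [MeasurableSpace α] {μ : Measure α} {f : α → ℝ}
    (hf : Measurable f) (h0 : ∀ x, 0 ≤ f x) {S : Set α} (hS : MeasurableSet S) :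
    (μ.withDensity fun x => ENNReal.ofReal (f x)).real S = ∫ x in S, f x ∂μ := by
  rw [Measure.real, withDensity_apply _ hS,
    integral_eq_lintegral_of_nonneg_ae (ae_of_all _ h0) hf.aestronglyMeasurable]

lemma gaussianLaw_real {σ : ℝ} (hσ : 0 < σ) (n : ℕ) {S : Set (Obs n)} (hS : MeasurableSet S) :
    (gaussianLaw σ n).real S = ∫ y in S, gaussianDensity σ n y :=
  real_withDensity_ofReal (measurable_gaussianDensity σ n)
    (fun y => (gaussianDensity_pos hσ n y).le) hS

lemma cauchyLaw_real {γ : ℝ} (hγ : 0 < γ) (n : ℕ) {S : Set (Obs n)} (hS : MeasurableSet S) :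
    (cauchyLaw γ n).real S = ∫ y in S, cauchyDensity γ n y :=
  real_withDensity_ofReal (measurable_cauchyDensity γ n)
    (fun y => (cauchyDensity_pos hγ n y).le) hS

/-! ### Neyman-Pearson optimality -/

lemma measurable_ratio (σ γ : ℝ) (n : ℕ) :
    Measurable fun y : Obs n => gaussianDensity σ n y / cauchyDensity γ n y :=
  (measurable_gaussianDensity σ n).div (measurable_cauchyDensity γ n)

lemma measurableSet_lrt (σ γ : ℝ) (n : ℕ) (η : ℝ) : MeasurableSet (lrt σ γ n η) :=
  measurableSet_le measurable_const (measurable_ratio σ γ n)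

/-- The Neyman-Pearson inequality. -/
lemma neyman_pearson {σ γ : ℝ} (hσ : 0 < σ) (hγ : 0 < γ) (n : ℕ) (η : ℝ) {B : Set (Obs n)}
    (hB : MeasurableSet B) :
    falseAlarm σ n (lrt σ γ n η) - falseAlarm σ n B ≤
      η * (detection γ n (lrt σ γ n η) - detection γ n B) := by
  have hA := (measurableSet_lrt σ γ n η).compl
  have hG := integrable_gaussianDensity hσ n
  have hC := (integrable_cauchyDensity hγ n).const_mul η
  have key : ∀ {S : Set (Obs n)}, MeasurableSet S →
      ∫ y, S.indicator (fun y => gaussianDensity σ n y - η * cauchyDensity γ n y) y =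
        (gaussianLaw σ n).real S - η * (cauchyLaw γ n).real S := by
    intro S hS
    rw [integral_indicator hS, gaussianLaw_real hσ n hS, cauchyLaw_real hγ n hS,
      integral_sub hG.integrableOn hC.integrableOn, integral_const_mul]
  -- The LRT rejects exactly where the integrand is negative, so its indicator is pointwise minimal
  -- among all rejection regions.
  have hle := integral_mono (((hG.sub hC).indicator hA)) ((hG.sub hC).indicator hB.compl)
    (fun y => by
      show (lrt σ γ n η)ᶜ.indicator
          (fun y => gaussianDensity σ n y - η * cauchyDensity γ n y) y ≤
        Bᶜ.indicator (fun y => gaussianDensity σ n y - η * cauchyDensity γ n y) y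
      have hc := cauchyDensity_pos hγ n y
      by_cases hy : y ∈ lrt σ γ n η
      · rw [Set.indicator_of_notMem (by simpa using hy)]
        have : η ≤ gaussianDensity σ n y / cauchyDensity γ n y := hy
        rw [le_div_iff₀ hc] at this
        by_cases hy' : y ∈ Bᶜ
        · rw [Set.indicator_of_mem hy']
          linarith
        · rw [Set.indicator_of_notMem hy']
      · rw [Set.indicator_of_mem (by simpa using hy)]
        have : ¬ η ≤ gaussianDensity σ n y / cauchyDensity γ n y := hy
        rw [le_div_iff₀ hc] at this
        by_cases hy' : y ∈ Bᶜ
        · rw [Set.indicator_of_mem hy']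
        · rw [Set.indicator_of_notMem hy']
          linarith)
  have e1 := key hA
  have e2 := key hB.compl
  simp only [falseAlarm, detection]
  change ∫ y, (lrt σ γ n η)ᶜ.indicator
      (fun y => gaussianDensity σ n y - η * cauchyDensity γ n y) y ≤
    ∫ y, Bᶜ.indicator (fun y => gaussianDensity σ n y - η * cauchyDensity γ n y) y at hle
  linarith

lemma optimalGivenFalseAlarm_lrt {σ γ ε η : ℝ} (hσ : 0 < σ) (hγ : 0 < γ) (hη : 0 < η) (n : ℕ)
    (h : falseAlarm σ n (lrt σ γ n η) = ε) :
    OptimalGivenFalseAlarm σ γ n ε (lrt σ γ n η) := by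
  refine ⟨measurableSet_lrt σ γ n η, h.le, fun B hB hBε => ?_⟩
  have := neyman_pearson hσ hγ n η hB
  by_contra! hlt
  nlinarith [mul_pos hη (sub_pos.2 hlt)]

lemma optimalGivenMiss_lrt {σ γ ε η : ℝ} (hσ : 0 < σ) (hγ : 0 < γ) (hη : 0 < η) (n : ℕ)
    (h : 1 - detection γ n (lrt σ γ n η) = ε) :
    OptimalGivenMiss σ γ n ε (lrt σ γ n η) := by
  refine ⟨measurableSet_lrt σ γ n η, h.le, fun B hB hBε => ?_⟩
  have := neyman_pearson hσ hγ n η hB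
  have h2 : detection γ n (lrt σ γ n η) ≤ detection γ n B := by linarith
  nlinarith [mul_nonneg hη.le (sub_nonneg.2 h2)]

/-! Level sets of the likelihood ratio -/

/-- Three points on one level would give two adjacent zero slopes, whereas slopes strictly decrease.
-/
lemma StrictConcaveOn.finite_level {s : Set ℝ} {f : ℝ → ℝ} (hf : StrictConcaveOn ℝ s f) (c : ℝ) :
    {t ∈ s | f t = c}.Finite := by
  have key : ∀ {x y z : ℝ}, x ∈ s → z ∈ s → x < y → y < z → f x = c → f y = c → f z = c →
      False := by
    intro x y z hx hz hxy hyz fx fy fz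
    have h1 := hf.slope_anti_adjacent hx hz hxy hyz
    simp [fx, fy, fz] at h1
  by_contra hinf
  obtain ⟨T, hT, hcard⟩ := Set.Infinite.exists_subset_card_eq hinf 3
  let e := T.orderIsoOfFin hcard
  have h0 := hT (e 0).2
  have h1 := hT (e 1).2
  have h2 := hT (e 2).2
  have h01 : (e 0 : ℝ) < e 1 := by exact_mod_cast e.lt_iff_lt.2 (by decide : (0 : Fin 3) < 1)
  have h12 : (e 1 : ℝ) < e 2 := by exact_mod_cast e.lt_iff_lt.2 (by decide : (1 : Fin 3) < 2)
  exact key h0.1 h2.1 h01 h12 h0.2 h1.2 h2.2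

/-- The variable is $t=\|y\|^2$: in it the Gaussian exponent is linear and the Cauchy factor
contributes a strictly concave logarithm. -/
lemma strictConcaveOn_logRatio {σ γ : ℝ} (hγ : 0 < γ) (n : ℕ) :
    StrictConcaveOn ℝ (Set.Ici 0) fun t : ℝ =>
      -t / (2 * σ ^ 2) + ((n : ℝ) + 1) / 2 * Real.log (1 + t / γ ^ 2) := by
  refine ⟨convex_Ici 0, fun x hx y hy hxy a b ha hb hab => ?_⟩
  have hx : 0 ≤ x := hx
  have hy : 0 ≤ y := hy
  have h := strictConcaveOn_log_Ioi.2 (x := 1 + x / γ ^ 2) (y := 1 + y / γ ^ 2)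
    (Set.mem_Ioi.2 (by positivity)) (Set.mem_Ioi.2 (by positivity))
    (fun h => hxy (by field_simp at h; linarith)) ha hb hab
  simp only [smul_eq_mul] at h ⊢
  have e : 1 + (a * x + b * y) / γ ^ 2 = a * (1 + x / γ ^ 2) + b * (1 + y / γ ^ 2) := by
    linear_combination -hab
  rw [e]
  have := mul_lt_mul_of_pos_left h (show 0 < ((n : ℝ) + 1) / 2 by positivity)
  have e2 : -(a * x + b * y) / (2 * σ ^ 2) =
      a * (-x / (2 * σ ^ 2)) + b * (-y / (2 * σ ^ 2)) := by ring
  rw [e2]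
  linarith

lemma log_ratio {σ γ : ℝ} (hσ : 0 < σ) (hγ : 0 < γ) (n : ℕ) (y : Obs n) :
    Real.log (gaussianDensity σ n y / cauchyDensity γ n y) =
      (-‖y‖ ^ 2 / (2 * σ ^ 2) + ((n : ℝ) + 1) / 2 * Real.log (1 + ‖y‖ ^ 2 / γ ^ 2)) +
      (Real.log (1 / (2 * Real.pi * σ ^ 2) ^ ((n : ℝ) / 2)) -
        Real.log (Real.Gamma (((n : ℝ) + 1) / 2) / (Real.pi ^ (((n : ℝ) + 1) / 2) * γ ^ n))) := by
  have := Real.pi_pos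
  have := Real.Gamma_pos_of_pos (s := ((n : ℝ) + 1) / 2) (by positivity)
  rw [Real.log_div (gaussianDensity_pos hσ n y).ne' (cauchyDensity_pos hγ n y).ne']
  unfold gaussianDensity cauchyDensity
  rw [Real.log_mul (by positivity) (by positivity), Real.log_exp,
    Real.log_mul (by positivity) (by positivity), one_div ((1 + ‖y‖ ^ 2 / γ ^ 2) ^ _),
    Real.log_inv, Real.log_rpow (by positivity)]
  ring

/-- A level set lies in finitely many spheres, which are null once the dimension is positive. -/
lemma volume_ratio_eq {σ γ : ℝ} (hσ : 0 < σ) (hγ : 0 < γ) {n : ℕ} (hn : 1 ≤ n) (c : ℝ) :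
    volume {y : Obs n | gaussianDensity σ n y / cauchyDensity γ n y = c} = 0 := by
  have : Nonempty (Fin n) := ⟨⟨0, hn⟩⟩
  set K := Real.log (1 / (2 * Real.pi * σ ^ 2) ^ ((n : ℝ) / 2)) -
    Real.log (Real.Gamma (((n : ℝ) + 1) / 2) / (Real.pi ^ (((n : ℝ) + 1) / 2) * γ ^ n))
  have hfin := StrictConcaveOn.finite_level (strictConcaveOn_logRatio (σ := σ) hγ n)
    (Real.log c - K)
  refine measure_mono_null (t := ⋃ t ∈ {t ∈ Set.Ici (0 : ℝ) |
      -t / (2 * σ ^ 2) + ((n : ℝ) + 1) / 2 * Real.log (1 + t / γ ^ 2) = Real.log c - K},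
      Metric.sphere (0 : Obs n) (Real.sqrt t)) ?_
    ((measure_biUnion_null_iff hfin.countable).2 fun t _ => Measure.addHaar_sphere _ _ _)
  intro y hy
  have hy : gaussianDensity σ n y / cauchyDensity γ n y = c := hy
  refine Set.mem_biUnion (x := ‖y‖ ^ 2) ⟨Set.mem_Ici.2 (by positivity), ?_⟩ ?_
  · rw [← hy, log_ratio hσ hγ]
    simp only [K]
    ring
  · simp [Real.sqrt_sq]

/-! Existence of thresholds -/

/-- The jump of a cdf at a point is the mass of that point. -/
lemma continuous_cdf (ν : Measure ℝ) [IsProbabilityMeasure ν] [NullSingletonClass ν] :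
    Continuous (cdf ν) := by
  rw [continuous_iff_continuousAt]
  intro x
  rw [(monotone_cdf ν).continuousAt_iff_leftLim_eq_rightLim]
  have h := (cdf ν).measure_singleton x
  rw [measure_cdf, measure_singleton] at h
  have h1 : cdf ν x - Function.leftLim (cdf ν) x ≤ 0 := ENNReal.ofReal_eq_zero.1 h.symm
  have h2 := (monotone_cdf ν).leftLim_le (le_refl x)
  rw [(cdf ν).rightLim_eq]
  linarith

lemma exists_cdf_eq (ν : Measure ℝ) [IsProbabilityMeasure ν] [NullSingletonClass ν] {ε : ℝ}
    (h0 : 0 < ε) (h1 : ε < 1) : ∃ x, cdf ν x = ε := by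
  obtain ⟨a, ha⟩ := ((tendsto_cdf_atBot ν).eventually_le_const h0).exists
  obtain ⟨b, hb⟩ := ((tendsto_cdf_atTop ν).eventually_const_le h1).exists
  exact mem_range_of_exists_le_of_exists_ge (continuous_cdf ν) ⟨a, ha⟩ ⟨b, hb⟩

lemma exists_threshold {σ γ : ℝ} (hσ : 0 < σ) (hγ : 0 < γ) {n : ℕ} (hn : 1 ≤ n)
    (μ : Measure (Obs n)) [IsProbabilityMeasure μ] (hμ : μ ≪ volume) {ε : ℝ}
    (h0 : 0 < ε) (h1 : ε < 1) : ∃ η : ℝ, 0 < η ∧ μ.real (lrt σ γ n η)ᶜ = ε := by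
  have hm := measurable_ratio σ γ n
  set R := fun y : Obs n => gaussianDensity σ n y / cauchyDensity γ n y with hR
  have : IsProbabilityMeasure (μ.map R) := Measure.isProbabilityMeasure_map hm.aemeasurable
  have : NullSingletonClass (μ.map R) := ⟨fun c => by
    rw [Measure.map_apply hm (measurableSet_singleton c)]
    exact hμ (volume_ratio_eq hσ hγ hn c)⟩
  obtain ⟨η, hη⟩ := exists_cdf_eq (μ.map R) h0 h1
  rw [cdf_eq_real] at hη
  refine ⟨η, ?_, ?_⟩
  · by_contra! hle
    rw [map_measureReal_apply hm measurableSet_Iic] at hη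
    have : R ⁻¹' Set.Iic η = ∅ := by
      ext y
      simp only [Set.mem_preimage, Set.mem_Iic, Set.mem_empty_iff_false, iff_false, not_le]
      exact hle.trans_lt (div_pos (gaussianDensity_pos hσ n y) (cauchyDensity_pos hγ n y))
    rw [this] at hη
    simp at hη
    linarith
  -- Rejection is the strict inequality; without atoms it has the same probability as the closed
  -- half-line seen by the cdf.
  · have e : (lrt σ γ n η)ᶜ = R ⁻¹' Set.Iio η := by
      ext y
      simp [lrt, hR]
    rw [e, ← map_measureReal_apply hm measurableSet_Iio, ← hη]
    exact measureReal_congr Iio_ae_eq_Iic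

lemma exists_falseAlarm_eq {σ γ : ℝ} (hσ : 0 < σ) (hγ : 0 < γ) {n : ℕ} (hn : 1 ≤ n) {ε : ℝ}
    (h0 : 0 < ε) (h1 : ε < 1) : ∃ η : ℝ, 0 < η ∧ falseAlarm σ n (lrt σ γ n η) = ε := by
  have := isProbabilityMeasure_gaussianLaw hσ n
  exact exists_threshold hσ hγ hn (gaussianLaw σ n) (withDensity_absolutelyContinuous _ _) h0 h1

lemma exists_miss_eq {σ γ : ℝ} (hσ : 0 < σ) (hγ : 0 < γ) {n : ℕ} (hn : 1 ≤ n) {ε : ℝ}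
    (h0 : 0 < ε) (h1 : ε < 1) : ∃ η : ℝ, 0 < η ∧ 1 - detection γ n (lrt σ γ n η) = ε := by
  have := isProbabilityMeasure_cauchyLaw hγ n
  obtain ⟨η, hη, h⟩ := exists_threshold hσ hγ hn (cauchyLaw γ n)
    (withDensity_absolutelyContinuous _ _) (ε := 1 - ε) (by linarith) (by linarith)
  exact ⟨η, hη, by rw [detection, h]; ring⟩

/-! Polar coordinates -/

/-- Log-convexity of $\Gamma$ at the midpoint of $s$ and $s+1$. -/
lemma Gamma_add_half_le {s : ℝ} (hs : 0 < s) :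
    Real.Gamma (s + 1 / 2) ≤ Real.sqrt s * Real.Gamma s := by
  have hG := Real.Gamma_pos_of_pos hs
  have h := Real.Gamma_mul_add_mul_le_rpow_Gamma_mul_rpow_Gamma (s := s) (t := s + 1)
    (a := 1 / 2) (b := 1 / 2) hs (by linarith) (by norm_num) (by norm_num) (by norm_num)
  rw [Real.Gamma_add_one hs.ne', Real.mul_rpow hs.le hG.le, ← Real.sqrt_eq_rpow,
    ← Real.sqrt_eq_rpow] at h
  have e : 1 / 2 * s + 1 / 2 * (s + 1) = s + 1 / 2 := by ring
  rw [e] at h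
  have := Real.mul_self_sqrt hG.le
  linarith [h, show √(Real.Gamma s) * (√s * √(Real.Gamma s)) =
    √s * (√(Real.Gamma s) * √(Real.Gamma s)) by ring, congrArg (√s * ·) this]

/-- The surface area of the unit sphere in `ℝⁿ`. -/
def sphereArea (n : ℕ) : ℝ := 2 * Real.pi ^ ((n : ℝ) / 2) / Real.Gamma ((n : ℝ) / 2)

lemma sphereArea_pos {n : ℕ} (hn : 1 ≤ n) : 0 < sphereArea n := by
  have := Real.pi_pos
  have := Real.Gamma_pos_of_pos (s := (n : ℝ) / 2) (by positivity)
  unfold sphereArea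
  positivity

lemma integral_radial {n : ℕ} (hn : 1 ≤ n) (F : ℝ → ℝ) :
    ∫ y : Obs n, F ‖y‖ = ∫ r in Set.Ioi (0 : ℝ), sphereArea n * r ^ (n - 1) * F r := by
  have : Nonempty (Fin n) := ⟨⟨0, hn⟩⟩
  have hn0 : 0 < (n : ℝ) := by exact_mod_cast hn
  rw [integral_fun_norm_addHaar, finrank_euclideanSpace_fin, Measure.real,
    EuclideanSpace.volume_ball]
  simp only [Fintype.card_fin, ENNReal.ofReal_one, one_pow, one_mul, smul_eq_mul, nsmul_eq_mul,
    mul_assoc, integral_const_mul]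
  have hG := Real.Gamma_pos_of_pos (s := (n : ℝ) / 2) (by positivity)
  rw [ENNReal.toReal_ofReal, Real.Gamma_add_one (by positivity), sphereArea, ← mul_assoc]
  · congr 1
    rw [Real.sqrt_eq_rpow, ← Real.rpow_natCast, ← Real.rpow_mul Real.pi_pos.le,
      show 1 / 2 * (n : ℝ) = n / 2 by ring]
    field_simp
  · rw [Real.Gamma_add_one (by positivity)]
    positivity

/-- The Cauchy density as a function of the norm of the observation. -/
def cauchyProfile (γ : ℝ) (n : ℕ) (r : ℝ) : ℝ :=
  Real.Gamma (((n : ℝ) + 1) / 2) / (Real.pi ^ (((n : ℝ) + 1) / 2) * γ ^ n)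
    * (1 / (1 + r ^ 2 / γ ^ 2) ^ (((n : ℝ) + 1) / 2))

lemma cauchyDensity_eq_profile (γ : ℝ) (n : ℕ) (y : Obs n) :
    cauchyDensity γ n y = cauchyProfile γ n ‖y‖ := rfl

lemma cauchyLaw_real_norm_mem {γ : ℝ} (hγ : 0 < γ) {n : ℕ} (hn : 1 ≤ n) {S : Set ℝ}
    (hS : MeasurableSet S) :
    (cauchyLaw γ n).real {y | ‖y‖ ∈ S} =
      ∫ r in Set.Ioi 0 ∩ S, sphereArea n * r ^ (n - 1) * cauchyProfile γ n r := by
  have hS' : MeasurableSet {y : Obs n | ‖y‖ ∈ S} := measurable_norm hS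
  rw [cauchyLaw_real hγ n hS', ← integral_indicator hS']
  have := integral_radial hn (S.indicator (cauchyProfile γ n))
  rw [← setIntegral_indicator hS]
  convert this using 1
  · refine integral_congr_ae (ae_of_all _ fun y => ?_)
    by_cases hy : ‖y‖ ∈ S <;> simp [hy, cauchyDensity_eq_profile]
  · refine integral_congr_ae (ae_of_all _ fun r => ?_)
    by_cases hr : r ∈ S <;> simp [hr]

/-! ### Cauchy mass of shells and tails, uniformly in the dimension -/

lemma sphereArea_mul_cauchy_le {γ : ℝ} (hγ : 0 < γ) {n : ℕ} (hn : 1 ≤ n) :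
    sphereArea n * (Real.Gamma (((n : ℝ) + 1) / 2) / (Real.pi ^ (((n : ℝ) + 1) / 2) * γ ^ n)) ≤
      Real.sqrt (2 * n / Real.pi) / γ ^ n := by
  have hpi := Real.pi_pos
  have hn0 : 0 < (n : ℝ) := by exact_mod_cast hn
  have hG := Real.Gamma_pos_of_pos (s := (n : ℝ) / 2) (by positivity)
  have h := Gamma_add_half_le (s := (n : ℝ) / 2) (by positivity)
  rw [← add_div] at h
  rw [sphereArea, add_div, Real.rpow_add hpi, ← Real.sqrt_eq_rpow, ← add_div]
  have hp : 0 < Real.pi ^ ((n : ℝ) / 2) := by positivity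
  have hsp : 0 < √Real.pi := by positivity
  have e : 2 * Real.pi ^ ((n : ℝ) / 2) / Real.Gamma (n / 2) *
      (Real.Gamma ((n + 1) / 2) / (Real.pi ^ ((n : ℝ) / 2) * √Real.pi * γ ^ n)) =
      2 * Real.Gamma ((n + 1) / 2) / (Real.Gamma (n / 2) * √Real.pi) / γ ^ n := by
    field_simp
  rw [e]
  gcongr
  rw [div_le_iff₀ (by positivity)]
  have e2 : √(2 * n / Real.pi) * (Real.Gamma (n / 2) * √Real.pi) =
      2 * (√(n / 2) * Real.Gamma (n / 2)) := by
    have : √(2 * n / Real.pi) = 2 * √(n / 2) / √Real.pi := by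
      rw [← Real.sqrt_sq (show (0 : ℝ) ≤ 2 by norm_num), ← Real.sqrt_mul (by norm_num),
        ← Real.sqrt_div (by positivity), Real.sqrt_sq (by norm_num)]
      congr 1
      ring
    rw [this]
    field_simp
  rw [e2]
  linarith

/-- Each of the $n$ terms of $1+u+\dots+u^{n-1}$ is at least $u^{n-1}$, and the sum times $1-u$ is
at most 1; the other factor $1+u$ is at most 2. This gain of $1/n$ makes the radial Cauchy density
$O(1/\sqrt n)$. -/
lemma pow_mul_one_sub_sq_le {u : ℝ} (h0 : 0 ≤ u) (h1 : u ≤ 1) {n : ℕ} (hn : 1 ≤ n) :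
    u ^ (n - 1) * (1 - u ^ 2) ≤ 2 / n := by
  have hn0 : 0 < (n : ℝ) := by exact_mod_cast hn
  have hsum : (n : ℝ) * u ^ (n - 1) ≤ ∑ k ∈ Finset.range n, u ^ k := by
    calc (n : ℝ) * u ^ (n - 1) = ∑ _k ∈ Finset.range n, u ^ (n - 1) := by simp
      _ ≤ _ := Finset.sum_le_sum fun k hk =>
        pow_le_pow_of_le_one h0 h1 (by have := Finset.mem_range.1 hk; omega)
  have hgeo := mul_neg_geom_sum u n
  have hpow : 0 ≤ u ^ n := by positivity
  have h2 : (n : ℝ) * u ^ (n - 1) * (1 - u) ≤ 1 := by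
    have := mul_le_mul_of_nonneg_right hsum (sub_nonneg.2 h1)
    linarith
  rw [le_div_iff₀ hn0]
  have h3 : 0 ≤ (n : ℝ) * u ^ (n - 1) * (1 - u) := by
    have := sub_nonneg.2 h1
    positivity
  nlinarith

/-- The radial Cauchy density is governed by `u = (r / γ) / √(1 + r² / γ²)`. -/
lemma cauchy_radial_le {γ : ℝ} (hγ : 0 < γ) {n : ℕ} (hn : 1 ≤ n) {r : ℝ} (hr : 0 < r) :
    sphereArea n * r ^ (n - 1) * cauchyProfile γ n r ≤
      Real.sqrt (2 * n / Real.pi) * (2 / (γ * n)) ∧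
    sphereArea n * r ^ (n - 1) * cauchyProfile γ n r ≤
      Real.sqrt (2 * n / Real.pi) * (γ / r ^ 2) := by
  have hn0 : 0 < (n : ℝ) := by exact_mod_cast hn
  set w := √(1 + r ^ 2 / γ ^ 2) with hw
  have hw2 : w ^ 2 = 1 + r ^ 2 / γ ^ 2 := Real.sq_sqrt (by positivity)
  have hw0 : 0 < w := Real.sqrt_pos.2 (by positivity)
  have hwn : (1 + r ^ 2 / γ ^ 2) ^ (((n : ℝ) + 1) / 2) = w ^ (n + 1) := by
    rw [hw, Real.sqrt_eq_rpow, ← Real.rpow_natCast _ (n + 1), ← Real.rpow_mul (by positivity)]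
    congr 1
    push_cast
    ring
  set u := r / γ / w with hu
  have hu0 : 0 < u := by positivity
  have hu2 : 1 - u ^ 2 = 1 / w ^ 2 := by
    rw [hu, div_pow, div_pow, eq_div_iff (by positivity), sub_mul, div_mul_cancel₀ _ (by positivity),
      hw2]
    ring
  have hu1 : u ≤ 1 := by
    have : 0 < 1 / w ^ 2 := by positivity
    nlinarith
  -- The first bound will use the decay in $n$ of $u^{n-1}(1-u^2)$, the second only $u\le1$ and
  -- $1-u^2\le\gamma^2/r^2$.
  have key : sphereArea n * r ^ (n - 1) * cauchyProfile γ n r ≤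
      √(2 * n / Real.pi) * (u ^ (n - 1) * (1 - u ^ 2) / γ) := by
    obtain ⟨m, rfl⟩ : ∃ m, n = m + 1 := ⟨n - 1, by omega⟩
    have h := sphereArea_mul_cauchy_le hγ hn
    have hb : 0 ≤ r ^ m * (1 / w ^ (m + 1 + 1)) := by positivity
    have := mul_le_mul_of_nonneg_right h hb
    rw [cauchyProfile, hwn, hu2, Nat.add_sub_cancel]
    refine (le_of_eq ?_).trans (this.trans (le_of_eq ?_))
    · ring
    · rw [hu, div_pow, div_pow]
      field_simp
      ring
  refine ⟨key.trans (mul_le_mul_of_nonneg_left ?_ (Real.sqrt_nonneg _)),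
    key.trans (mul_le_mul_of_nonneg_left ?_ (Real.sqrt_nonneg _))⟩
  · rw [show 2 / (γ * (n : ℝ)) = 2 / n / γ by field_simp]
    gcongr
    exact pow_mul_one_sub_sq_le hu0.le hu1 hn
  · have h1 : u ^ (n - 1) ≤ 1 := pow_le_one₀ hu0.le hu1
    have h2 : 1 - u ^ 2 ≤ γ ^ 2 / r ^ 2 := by
      rw [hu2, hw2, div_le_div_iff₀ (by positivity) (by positivity), mul_add,
        mul_div_cancel₀ _ (by positivity)]
      nlinarith [sq_nonneg γ]
    have h3 : 0 ≤ 1 - u ^ 2 := by rw [hu2]; positivity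
    calc u ^ (n - 1) * (1 - u ^ 2) / γ ≤ 1 * (γ ^ 2 / r ^ 2) / γ := by gcongr
      _ = γ / r ^ 2 := by field_simp

lemma cauchyProfile_nonneg {γ : ℝ} (hγ : 0 < γ) (n : ℕ) (r : ℝ) : 0 ≤ cauchyProfile γ n r := by
  have := Real.pi_pos
  have := Real.Gamma_pos_of_pos (s := ((n : ℝ) + 1) / 2) (by positivity)
  unfold cauchyProfile
  positivity

/-- The radial density is $O(1/\sqrt n)$ and the radii fill an interval of length $(b-a)\sqrt n$, so
$n$ cancels. -/
lemma cauchyLaw_real_shell_le {γ : ℝ} (hγ : 0 < γ) {n : ℕ} (hn : 1 ≤ n) {S : Set ℝ}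
    (hS : MeasurableSet S) {a b : ℝ} (hab : a ≤ b)
    (hSab : Set.Ioi 0 ∩ S ⊆ Set.Icc (a * √n) (b * √n)) :
    (cauchyLaw γ n).real {y | ‖y‖ ∈ S} ≤ 2 * √(2 / Real.pi) / γ * (b - a) := by
  have hn0 : 0 < (n : ℝ) := by exact_mod_cast hn
  have hT : volume (Set.Ioi 0 ∩ S) ≤ ENNReal.ofReal ((b - a) * √n) := by
    refine (measure_mono hSab).trans ?_
    rw [Real.volume_Icc, sub_mul]
  rw [cauchyLaw_real_norm_mem hγ hn hS]
  have h := norm_setIntegral_le_of_norm_le_const (μ := volume) (s := Set.Ioi 0 ∩ S)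
    (f := fun r => sphereArea n * r ^ (n - 1) * cauchyProfile γ n r)
    (C := √(2 * n / Real.pi) * (2 / (γ * n))) (hT.trans_lt ENNReal.ofReal_lt_top)
    (fun r hr => by
      have hr0 : 0 < r := hr.1
      have := sphereArea_pos hn
      have := cauchyProfile_nonneg hγ n r
      rw [Real.norm_of_nonneg (by positivity)]
      exact (cauchy_radial_le hγ hn hr0).1)
  refine (Real.le_norm_self _).trans (h.trans ?_)
  have hv : volume.real (Set.Ioi 0 ∩ S) ≤ (b - a) * √n :=
    ENNReal.toReal_le_of_le_ofReal (mul_nonneg (sub_nonneg.2 hab) (by positivity)) hT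
  calc √(2 * n / Real.pi) * (2 / (γ * n)) * volume.real (Set.Ioi 0 ∩ S)
      ≤ √(2 * n / Real.pi) * (2 / (γ * n)) * ((b - a) * √n) := by gcongr
    _ = 2 * √(2 / Real.pi) / γ * (b - a) := by
      have hpi := Real.pi_pos
      rw [show 2 * (n : ℝ) / Real.pi = 2 / Real.pi * n by ring, Real.sqrt_mul (by positivity)]
      have hs : √(n : ℝ) * √n = n := Real.mul_self_sqrt hn0.le
      have : √(2 / Real.pi) * √n * (2 / (γ * n)) * ((b - a) * √n) =
        √(2 / Real.pi) * (2 / (γ * n)) * (b - a) * (√(n : ℝ) * √n) := by ring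
      rw [this, hs]
      field_simp

/-- Integrating the bound of order $\sqrt n/r^2$ beyond $M\sqrt n$ again removes $n$. -/
lemma cauchyLaw_real_tail_le {γ : ℝ} (hγ : 0 < γ) {n : ℕ} (hn : 1 ≤ n) {M : ℝ} (hM : 0 < M) :
    (cauchyLaw γ n).real {y | ‖y‖ ∈ Set.Ioi (M * √n)} ≤ √(2 / Real.pi) * γ / M := by
  have hpi := Real.pi_pos
  have hn0 : 0 < (n : ℝ) := by exact_mod_cast hn
  have hc : 0 < M * √n := by positivity
  rw [cauchyLaw_real_norm_mem hγ hn measurableSet_Ioi, Set.inter_eq_right.2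
    (Set.Ioi_subset_Ioi hc.le)]
  have hint : IntegrableOn (fun r : ℝ => √(2 * n / Real.pi) * (γ * r ^ (-2 : ℝ)))
      (Set.Ioi (M * √n)) :=
    ((integrableOn_Ioi_rpow_of_lt (by norm_num) hc).const_mul γ).const_mul _
  have hle : ∫ r in Set.Ioi (M * √n), sphereArea n * r ^ (n - 1) * cauchyProfile γ n r ≤
      ∫ r in Set.Ioi (M * √n), √(2 * n / Real.pi) * (γ * r ^ (-2 : ℝ)) := by
    refine integral_mono_of_nonneg ?_ hint ?_
    · refine (ae_restrict_iff' measurableSet_Ioi).2 (ae_of_all _ fun r hr => ?_)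
      have hr0 : 0 < r := hc.trans hr
      have := sphereArea_pos hn
      have := cauchyProfile_nonneg hγ n r
      simp only [Pi.zero_apply]
      positivity
    · refine (ae_restrict_iff' measurableSet_Ioi).2 (ae_of_all _ fun r hr => ?_)
      have hr0 : 0 < r := hc.trans hr
      have e : γ * r ^ (-2 : ℝ) = γ / r ^ 2 := by
        rw [Real.rpow_neg hr0.le, Real.rpow_two, div_eq_mul_inv]
      simp only [e]
      exact (cauchy_radial_le hγ hn hr0).2
  refine hle.trans (le_of_eq ?_)
  rw [integral_const_mul, integral_const_mul, integral_Ioi_rpow_of_lt (by norm_num) hc,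
    show (-2 : ℝ) + 1 = -1 by norm_num, Real.rpow_neg_one, show 2 * (n : ℝ) / Real.pi =
      2 / Real.pi * n by ring, Real.sqrt_mul (by positivity)]
  field_simp

/-! Exponential bounds -/

/-- Chernoff's bound for the squared norm of a Gaussian vector, both tails at once. -/
lemma gaussianLaw_real_chernoff {σ : ℝ} (hσ : 0 < σ) (n : ℕ) {d : ℝ} (hd : -1 < d) :
    (gaussianLaw σ n).real {y | 0 ≤ d * (‖y‖ ^ 2 - n * σ ^ 2 * (1 + d))} ≤
      Real.exp (-((d - Real.log (1 + d)) / 2) * n) := by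
  have hpi := Real.pi_pos
  have hd0 : 0 < 1 + d := by linarith
  have hS : MeasurableSet {y : Obs n | 0 ≤ d * (‖y‖ ^ 2 - n * σ ^ 2 * (1 + d))} :=
    measurableSet_le measurable_const (by fun_prop)
  rw [gaussianLaw_real hσ n hS]
  -- The optimal tilt: the comparison Gaussian has variance $\sigma^2(1+d)$, so its mean squared
  -- norm is exactly the cut-off. The sign of $d$ selects the tail.
  set b := 1 / (2 * σ ^ 2 * (1 + d)) with hb
  have hb0 : 0 < b := by positivity
  set c := 1 / (2 * Real.pi * σ ^ 2) ^ ((n : ℝ) / 2) * Real.exp (-(d * n / 2)) with hc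
  have hint : Integrable fun y : Obs n => c * Real.exp (-b * ‖y‖ ^ 2) :=
    (integrable_exp_neg_mul_sq hb0 n).const_mul c
  calc ∫ y in {y : Obs n | 0 ≤ d * (‖y‖ ^ 2 - n * σ ^ 2 * (1 + d))}, gaussianDensity σ n y
      ≤ ∫ y in {y : Obs n | 0 ≤ d * (‖y‖ ^ 2 - n * σ ^ 2 * (1 + d))},
          c * Real.exp (-b * ‖y‖ ^ 2) := by
        refine setIntegral_mono_on (integrable_gaussianDensity hσ n).integrableOn
          hint.integrableOn hS fun y hy => ?_
        have hy : 0 ≤ d * (‖y‖ ^ 2 - n * σ ^ 2 * (1 + d)) := hy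
        rw [hc, mul_assoc, ← Real.exp_add, gaussianDensity]
        gcongr
        have h1 : 0 ≤ b * (d * (‖y‖ ^ 2 - n * σ ^ 2 * (1 + d))) := by positivity
        have e : b * (d * (‖y‖ ^ 2 - n * σ ^ 2 * (1 + d))) =
            (-(d * n / 2) + -b * ‖y‖ ^ 2) - -‖y‖ ^ 2 / (2 * σ ^ 2) := by
          rw [hb]
          field_simp
          ring
        linarith
    _ ≤ ∫ y, c * Real.exp (-b * ‖y‖ ^ 2) :=
        setIntegral_le_integral hint (ae_of_all _ fun y => by
          simp only [Pi.zero_apply]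
          positivity)
    _ = _ := by
        rw [integral_const_mul, integral_exp_neg_mul_sq hb0, hc,
          show Real.pi / b = (2 * Real.pi * σ ^ 2) * (1 + d) by rw [hb]; field_simp,
          Real.mul_rpow (by positivity) hd0.le]
        have : (1 + d) ^ ((n : ℝ) / 2) = Real.exp (Real.log (1 + d) * (n / 2)) :=
          Real.rpow_def_of_pos hd0 _
        rw [this]
        have hp : 0 < (2 * Real.pi * σ ^ 2) ^ ((n : ℝ) / 2) := by positivity
        field_simp
        rw [← Real.exp_add]
        congr 1
        ring

lemma sub_log_one_add_pos {d : ℝ} (hd : -1 < d) (hd0 : d ≠ 0) : 0 < d - Real.log (1 + d) := by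
  have := Real.log_lt_sub_one_of_pos (x := 1 + d) (by linarith) (by simpa using hd0)
  linarith

/-- Half of the exponential rate is spent on absorbing $\sqrt n\le n\le(2/c)e^{cn/2}$. -/
lemma exp_neg_le_div_sqrt {c : ℝ} (hc : 0 < c) {n : ℕ} (hn : 1 ≤ n) :
    Real.exp (-c * n) ≤ 2 / c * Real.exp (-(c / 2) * n) / √n := by
  have hn1 : (1 : ℝ) ≤ n := by exact_mod_cast hn
  have hs : 0 < √(n : ℝ) := by positivity
  rw [le_div_iff₀ hs]
  have h1 : √(n : ℝ) ≤ n := by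
    rw [Real.sqrt_le_left (by linarith)]
    nlinarith
  have h2 : c / 2 * n ≤ Real.exp (c / 2 * n) := by
    linarith [Real.add_one_le_exp (c / 2 * n)]
  have h3 : √(n : ℝ) ≤ 2 / c * Real.exp (c / 2 * n) := by
    calc √(n : ℝ) ≤ 2 / c * (c / 2 * n) := by field_simp; exact h1
      _ ≤ _ := by gcongr
  calc Real.exp (-c * n) * √n ≤ Real.exp (-c * n) * (2 / c * Real.exp (c / 2 * n)) := by gcongr
    _ = 2 / c * (Real.exp (-c * n) * Real.exp (c / 2 * n)) := by ring
    _ = 2 / c * Real.exp (-(c / 2) * n) := by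
      rw [← Real.exp_add]
      congr 2
      ring

/-- By optimality it suffices to exhibit one detector with miss at most $\varepsilon$ and
exponentially small false alarm: a thin shell around $\sigma\sqrt n$. -/
lemma exists_falseAlarm_le {σ γ ε : ℝ} (hσ : 0 < σ) (hγ : 0 < γ) (hε : 0 < ε) :
    ∃ κ₃ κ₄ : ℝ, 0 < κ₃ ∧ 0 < κ₄ ∧ ∀ n : ℕ, 1 ≤ n → ∀ η : ℝ, 0 < η →
      1 - detection γ n (lrt σ γ n η) = ε →
      falseAlarm σ n (lrt σ γ n η) ≤ κ₃ * Real.exp (-κ₄ * n) / √n := by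
  have hpi := Real.pi_pos
  set K := 2 * √(2 / Real.pi) / γ with hK
  have hK0 : 0 < K := by positivity
  -- The shell has relative half-width $\delta$ and Cauchy mass at most
  -- $2K\sigma\delta\le\varepsilon$; the cap $1/2$ keeps its inner radius positive.
  set δ := min (1 / 2) (ε / (K * (2 * σ))) with hδ
  have hδ0 : 0 < δ := lt_min (by norm_num) (by positivity)
  have hδ1 : δ ≤ 1 / 2 := min_le_left _ _
  have hδ2 : K * (2 * σ) * δ ≤ ε := by
    have := min_le_right (1 / 2) (ε / (K * (2 * σ)))
    rwa [← hδ, le_div_iff₀' (by positivity)] at this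
  -- Chosen so that $n\sigma^2(1+d_i)$ are the squared inner and outer radii of the shell.
  set d₁ := (1 - δ) ^ 2 - 1 with hd₁
  set d₂ := (1 + δ) ^ 2 - 1 with hd₂
  have hd₁n : d₁ < 0 := by nlinarith
  have hd₁' : -1 < d₁ := by nlinarith
  have hd₂p : 0 < d₂ := by nlinarith
  have h₁ := sub_log_one_add_pos hd₁' hd₁n.ne
  have h₂ := sub_log_one_add_pos (by linarith) hd₂p.ne'
  set c := min ((d₁ - Real.log (1 + d₁)) / 2) ((d₂ - Real.log (1 + d₂)) / 2) with hc
  have hc0 : 0 < c := lt_min (by linarith) (by linarith)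
  refine ⟨2 * (2 / c), c / 2, by positivity, by positivity, fun n hn η hη h => ?_⟩
  have hn0 : 0 < (n : ℝ) := by exact_mod_cast hn
  have := isProbabilityMeasure_gaussianLaw hσ n
  have := isProbabilityMeasure_cauchyLaw hγ n
  set S := Set.Ioo (σ * (1 - δ) * √n) (σ * (1 + δ) * √n) with hS
  have hB : MeasurableSet {y : Obs n | ‖y‖ ∈ S} := measurable_norm measurableSet_Ioo
  have hmiss : 1 - detection γ n {y : Obs n | ‖y‖ ∈ S} ≤ ε := by
    have h1 := cauchyLaw_real_shell_le hγ hn measurableSet_Ioo (S := S)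
      (a := σ * (1 - δ)) (b := σ * (1 + δ)) (by nlinarith)
      (Set.inter_subset_right.trans Set.Ioo_subset_Icc_self)
    rw [detection, probReal_compl_eq_one_sub hB]
    have : K * (σ * (1 + δ) - σ * (1 - δ)) = K * (2 * σ) * δ := by ring
    linarith
  refine ((optimalGivenMiss_lrt hσ hγ hη n h).2.2 _ hB hmiss).trans ?_
  have hsn : √(n : ℝ) ^ 2 = n := Real.sq_sqrt hn0.le
  have hsub : {y : Obs n | ‖y‖ ∈ S}ᶜ ⊆
      {y | 0 ≤ d₁ * (‖y‖ ^ 2 - n * σ ^ 2 * (1 + d₁))} ∪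
      {y | 0 ≤ d₂ * (‖y‖ ^ 2 - n * σ ^ 2 * (1 + d₂))} := by
    intro y hy
    have hy : ¬ (σ * (1 - δ) * √n < ‖y‖ ∧ ‖y‖ < σ * (1 + δ) * √n) := hy
    by_cases hlo : σ * (1 - δ) * √n < ‖y‖
    · right
      have hhi : σ * (1 + δ) * √n ≤ ‖y‖ := by
        by_contra! hlt
        exact hy ⟨hlo, hlt⟩
      have := pow_le_pow_left₀ (by positivity) hhi 2
      rw [mul_pow, mul_pow, hsn] at this
      exact mul_nonneg hd₂p.le (by rw [hd₂]; linarith)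
    · left
      have := pow_le_pow_left₀ (norm_nonneg y) (not_lt.1 hlo) 2
      rw [mul_pow, mul_pow, hsn] at this
      exact mul_nonneg_of_nonpos_of_nonpos hd₁n.le (by rw [hd₁]; linarith)
  have e₁ : Real.exp (-((d₁ - Real.log (1 + d₁)) / 2) * n) ≤ Real.exp (-c * n) := by
    gcongr
    exact min_le_left _ _
  have e₂ : Real.exp (-((d₂ - Real.log (1 + d₂)) / 2) * n) ≤ Real.exp (-c * n) := by
    gcongr
    exact min_le_right _ _
  calc falseAlarm σ n {y : Obs n | ‖y‖ ∈ S} ≤ _ := measureReal_mono hsub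
    _ ≤ _ := measureReal_union_le _ _
    _ ≤ 2 * Real.exp (-c * n) := by
      linarith [gaussianLaw_real_chernoff hσ n hd₁',
        gaussianLaw_real_chernoff hσ n (show -1 < d₂ by linarith)]
    _ ≤ 2 * (2 / c * Real.exp (-(c / 2) * n) / √n) := by
      gcongr
      exact exp_neg_le_div_sqrt hc0 hn
    _ = _ := by ring

/-! ### Lower bound on the false alarm -/

/-- A crude Stirling bound by half-steps of $\Gamma$; the exponential factor it loses only affects
$\kappa_2$. -/
lemma Gamma_half_le (n : ℕ) : Real.Gamma (((n : ℝ) + 1) / 2) ≤ √Real.pi * √n ^ n := by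
  induction n with
  | zero => simpa using Real.Gamma_one_half_eq.le
  | succ n ih =>
    have h := Gamma_add_half_le (s := ((n : ℝ) + 1) / 2) (by positivity)
    have e : (((n + 1 : ℕ) : ℝ) + 1) / 2 = ((n : ℝ) + 1) / 2 + 1 / 2 := by push_cast; ring
    rw [e]
    have hn : (0 : ℝ) ≤ n := n.cast_nonneg
    calc _ ≤ √(((n : ℝ) + 1) / 2) * (√Real.pi * √n ^ n) := h.trans (by gcongr)
      _ ≤ √((n + 1 : ℕ) : ℝ) * (√Real.pi * √((n + 1 : ℕ) : ℝ) ^ n) := by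
        push_cast
        gcongr <;> linarith
      _ = _ := by ring

/-- At radii of order $\sqrt n$ the $\sqrt n^{\,n}$ from $\Gamma$ cancels the one from the norm,
leaving $p_C\le(\sqrt\pi\,m)^{-n}$; the Gaussian density is also at least exponential there. -/
lemma cauchyDensity_le_mul_gaussianDensity {σ γ m M : ℝ} (hσ : 0 < σ) (hγ : 0 < γ) (hm : 0 < m)
    {n : ℕ} (hn : 1 ≤ n) {y : Obs n} (hy₁ : m * √n ≤ ‖y‖) (hy₂ : ‖y‖ ≤ M * √n) :
    Real.exp ((Real.log (m / (√2 * σ)) - M ^ 2 / (2 * σ ^ 2)) * n) * cauchyDensity γ n y ≤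
      gaussianDensity σ n y := by
  have hpi := Real.pi_pos
  have hn0 : 0 < (n : ℝ) := by exact_mod_cast hn
  have hsn : √(n : ℝ) ^ 2 = n := Real.sq_sqrt hn0.le
  have hG := Real.Gamma_pos_of_pos (s := ((n : ℝ) + 1) / 2) (by positivity)
  have hy0 : 0 < ‖y‖ := lt_of_lt_of_le (by positivity) hy₁
  have hbase : (m * √n / γ) ^ n ≤ (1 + ‖y‖ ^ 2 / γ ^ 2) ^ (((n : ℝ) + 1) / 2) := by
    calc (m * √n / γ) ^ n ≤ (‖y‖ / γ) ^ n := by gcongr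
      _ = ((‖y‖ / γ) ^ 2) ^ ((n : ℝ) / 2) := by
        rw [← Real.rpow_natCast _ n, ← Real.rpow_natCast _ 2, ← Real.rpow_mul (by positivity)]
        congr 1
        push_cast
        ring
      _ ≤ (1 + ‖y‖ ^ 2 / γ ^ 2) ^ ((n : ℝ) / 2) := by
        rw [div_pow]
        gcongr
        linarith
      _ ≤ _ := by
        refine Real.rpow_le_rpow_of_exponent_le ?_ (by linarith)
        have : 0 ≤ ‖y‖ ^ 2 / γ ^ 2 := by positivity
        linarith
  have hcle : cauchyDensity γ n y ≤ 1 / (√Real.pi ^ n * m ^ n) := by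
    calc cauchyDensity γ n y
        ≤ √Real.pi * √n ^ n / (Real.pi ^ (((n : ℝ) + 1) / 2) * γ ^ n) *
          (1 / (m * √n / γ) ^ n) := by
          unfold cauchyDensity
          gcongr
          exact Gamma_half_le n
      _ = 1 / (√Real.pi ^ n * m ^ n) := by
          have : Real.pi ^ (((n : ℝ) + 1) / 2) = √Real.pi ^ n * √Real.pi := by
            rw [← pow_succ, Real.sqrt_eq_rpow, ← Real.rpow_natCast _ (n + 1),
              ← Real.rpow_mul hpi.le]
            congr 1
            push_cast
            ring
          rw [this, div_pow, mul_pow]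
          have : 0 < √Real.pi := by positivity
          field_simp
  have hexp : Real.exp ((Real.log (m / (√2 * σ)) - M ^ 2 / (2 * σ ^ 2)) * n) =
      (m / (√2 * σ)) ^ n * Real.exp (-(M ^ 2 * n) / (2 * σ ^ 2)) := by
    rw [sub_mul, sub_eq_add_neg, Real.exp_add, mul_comm (Real.log _), Real.exp_nat_mul,
      Real.exp_log (by positivity)]
    congr 2
    ring
  have hnorm : (2 * Real.pi * σ ^ 2) ^ ((n : ℝ) / 2) = (√2 * √Real.pi * σ) ^ n := by
    have : 2 * Real.pi * σ ^ 2 = (√2 * √Real.pi * σ) ^ 2 := by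
      rw [mul_pow, mul_pow, Real.sq_sqrt (by norm_num), Real.sq_sqrt hpi.le]
    rw [this, ← Real.rpow_natCast _ 2, ← Real.rpow_mul (by positivity), ← Real.rpow_natCast _ n]
    congr 1
    push_cast
    ring
  calc _ ≤ Real.exp ((Real.log (m / (√2 * σ)) - M ^ 2 / (2 * σ ^ 2)) * n) *
        (1 / (√Real.pi ^ n * m ^ n)) := by gcongr
    _ = 1 / (2 * Real.pi * σ ^ 2) ^ ((n : ℝ) / 2) *
        Real.exp (-(M ^ 2 * n) / (2 * σ ^ 2)) := by
      rw [hexp, hnorm, div_pow, mul_pow, mul_pow, mul_pow]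
      have : 0 < √Real.pi := by positivity
      field_simp
    _ ≤ gaussianDensity σ n y := by
      unfold gaussianDensity
      gcongr
      calc ‖y‖ ^ 2 ≤ (M * √n) ^ 2 := by gcongr
        _ = M ^ 2 * n := by rw [mul_pow, hsn]

lemma exists_le_falseAlarm {σ γ ε : ℝ} (hσ : 0 < σ) (hγ : 0 < γ) (hε : ε < 1) :
    ∃ κ₁ κ₂ : ℝ, 0 < κ₁ ∧ 0 < κ₂ ∧ ∀ n : ℕ, 1 ≤ n → ∀ A : Set (Obs n), MeasurableSet A →
      1 - detection γ n A = ε → κ₁ * Real.exp (-κ₂ * n) / √n ≤ falseAlarm σ n A := by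
  have hpi := Real.pi_pos
  have hε' : 0 < 1 - ε := by linarith
  -- The radii $m\sqrt n$ and $M\sqrt n$ each cut off Cauchy mass at most $(1-\varepsilon)/4$, so at
  -- least half of the rejection mass $1-\varepsilon$ survives between them.
  set m := (1 - ε) / 4 / (2 * √(2 / Real.pi) / γ) with hm
  have hm0 : 0 < m := by positivity
  set M := √(2 / Real.pi) * γ / ((1 - ε) / 4) with hM
  have hM0 : 0 < M := by positivity
  set κ := Real.log (m / (√2 * σ)) - M ^ 2 / (2 * σ ^ 2) with hκ
  -- The sign of $\kappa$ is not known; the maximum keeps the rate positive.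
  refine ⟨(1 - ε) / 2, max 1 (-κ), by positivity, by positivity, fun n hn A hA h => ?_⟩
  have hn1 : (1 : ℝ) ≤ n := by exact_mod_cast hn
  have hs1 : 1 ≤ √(n : ℝ) := by
    rw [Real.one_le_sqrt]
    exact hn1
  have := isProbabilityMeasure_gaussianLaw hσ n
  have := isProbabilityMeasure_cauchyLaw hγ n
  have hlo : (cauchyLaw γ n).real {y : Obs n | ‖y‖ ∈ Set.Iic (m * √n)} ≤ (1 - ε) / 4 := by
    refine (cauchyLaw_real_shell_le hγ hn measurableSet_Iic hm0.le (fun r hr => ?_)).trans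
      (le_of_eq ?_)
    · rw [zero_mul]
      exact ⟨le_of_lt hr.1, hr.2⟩
    · rw [hm, sub_zero]
      field_simp
  have hhi : (cauchyLaw γ n).real {y : Obs n | ‖y‖ ∈ Set.Ioi (M * √n)} ≤ (1 - ε) / 4 := by
    refine (cauchyLaw_real_tail_le hγ hn hM0).trans (le_of_eq ?_)
    rw [hM]
    field_simp
  set T := {y : Obs n | m * √n ≤ ‖y‖ ∧ ‖y‖ ≤ M * √n} with hT
  have hTm : MeasurableSet T :=
    (measurableSet_le measurable_const measurable_norm).inter
      (measurableSet_le measurable_norm measurable_const)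
  have hsub : Aᶜ ⊆ (Aᶜ ∩ T) ∪ ({y : Obs n | ‖y‖ ∈ Set.Iic (m * √n)} ∪
      {y : Obs n | ‖y‖ ∈ Set.Ioi (M * √n)}) := by
    intro y hy
    by_cases h1 : ‖y‖ ≤ m * √n
    · exact Or.inr (Or.inl h1)
    · by_cases h2 : M * √n < ‖y‖
      · exact Or.inr (Or.inr h2)
      · exact Or.inl ⟨hy, (not_le.1 h1).le, not_lt.1 h2⟩
  have hmass : (1 - ε) / 2 ≤ (cauchyLaw γ n).real (Aᶜ ∩ T) := by
    have h1 : (cauchyLaw γ n).real Aᶜ = 1 - ε := by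
      rw [detection] at h
      linarith
    have h2 := (measureReal_mono (μ := cauchyLaw γ n) hsub).trans (measureReal_union_le _ _)
    have h3 := measureReal_union_le (μ := cauchyLaw γ n) {y : Obs n | ‖y‖ ∈ Set.Iic (m * √n)}
      {y : Obs n | ‖y‖ ∈ Set.Ioi (M * √n)}
    linarith
  have hATm : MeasurableSet (Aᶜ ∩ T) := hA.compl.inter hTm
  have hcompare : Real.exp (κ * n) * (cauchyLaw γ n).real (Aᶜ ∩ T) ≤
      (gaussianLaw σ n).real (Aᶜ ∩ T) := by
    rw [cauchyLaw_real hγ n hATm, gaussianLaw_real hσ n hATm, ← integral_const_mul]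
    exact setIntegral_mono_on ((integrable_cauchyDensity hγ n).const_mul _).integrableOn
      (integrable_gaussianDensity hσ n).integrableOn hATm fun y hy =>
      cauchyDensity_le_mul_gaussianDensity hσ hγ hm0 hn hy.2.1 hy.2.2
  calc (1 - ε) / 2 * Real.exp (-(max 1 (-κ)) * n) / √n
      ≤ (1 - ε) / 2 * Real.exp (-(max 1 (-κ)) * n) := div_le_self (by positivity) hs1
    _ ≤ (1 - ε) / 2 * Real.exp (κ * n) := by
        gcongr
        linarith [le_max_right 1 (-κ)]
    _ ≤ (cauchyLaw γ n).real (Aᶜ ∩ T) * Real.exp (κ * n) := by gcongr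
    _ ≤ (gaussianLaw σ n).real (Aᶜ ∩ T) := by rw [mul_comm]; exact hcompare
    _ ≤ falseAlarm σ n A := measureReal_mono Set.inter_subset_left

/-! Asymptotics of the normalizing constants -/

/-- Squeezed by `Gamma_add_half_le` at $s=n/2$ from above and at $s=(n+1)/2$ from below. -/
lemma tendsto_Gamma_ratio : Tendsto (fun n : ℕ =>
    Real.Gamma (((n : ℝ) + 1) / 2) / Real.Gamma ((n : ℝ) / 2) / √((n : ℝ) / 2))
    atTop (nhds 1) := by
  have hlow : Tendsto (fun n : ℕ => √((n : ℝ) / ((n : ℝ) + 1))) atTop (nhds 1) := by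
    have := (tendsto_natCast_div_add_atTop (𝕜 := ℝ) 1).sqrt
    simpa using this
  refine tendsto_of_tendsto_of_tendsto_of_le_of_le' hlow tendsto_const_nhds ?_ ?_
  · filter_upwards [eventually_ge_atTop 1] with n hn
    have hn0 : 0 < (n : ℝ) := by exact_mod_cast hn
    have hG := Real.Gamma_pos_of_pos (s := (n : ℝ) / 2) (by positivity)
    have h := Gamma_add_half_le (s := ((n : ℝ) + 1) / 2) (by positivity)
    rw [show ((n : ℝ) + 1) / 2 + 1 / 2 = n / 2 + 1 by ring,
      Real.Gamma_add_one (by positivity)] at h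
    rw [le_div_iff₀ (by positivity), le_div_iff₀ hG]
    have e : √((n : ℝ) / (n + 1)) * √(n / 2) = (n / 2) / √((n + 1) / 2) := by
      rw [← Real.sqrt_mul (by positivity), eq_div_iff (by positivity),
        ← Real.sqrt_mul (by positivity)]
      rw [show (n : ℝ) / (n + 1) * (n / 2) * ((n + 1) / 2) = (n / 2) ^ 2 by field_simp]
      exact Real.sqrt_sq (by positivity)
    rw [e, div_mul_eq_mul_div, div_le_iff₀ (by positivity)]
    linarith
  · filter_upwards [eventually_ge_atTop 1] with n hn
    have hn0 : 0 < (n : ℝ) := by exact_mod_cast hn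
    have hG := Real.Gamma_pos_of_pos (s := (n : ℝ) / 2) (by positivity)
    have h := Gamma_add_half_le (s := (n : ℝ) / 2) (by positivity)
    rw [← add_div] at h
    rw [div_le_one (by positivity), div_le_iff₀ hG]
    exact h

/-- Write $\Gamma(\frac{n+1}2)^2$ as the ratio $\Gamma(\frac{n+1}2)/\Gamma(\frac n2)$ times the
product of the two values. The duplication formula turns the product into a factorial, Stirling
applies, and a square root is taken. -/
lemma tendsto_Gamma_stirling : Tendsto (fun n : ℕ =>
    Real.Gamma (((n : ℝ) + 1) / 2) / (√((n : ℝ) / 2) ^ n * Real.exp (-(n / 2))))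
    atTop (nhds √(2 * Real.pi)) := by
  have hpi := Real.pi_pos
  have hlim := (tendsto_Gamma_ratio.mul
    (Stirling.tendsto_stirlingSeq_sqrt_pi.mul_const (2 * √Real.pi))).sqrt
  rw [show 1 * (√Real.pi * (2 * √Real.pi)) = 2 * Real.pi by
    linarith [Real.mul_self_sqrt hpi.le]] at hlim
  refine hlim.congr' ?_
  filter_upwards [eventually_ge_atTop 1] with n hn
  have hn0 : 0 < (n : ℝ) := by exact_mod_cast hn
  have hG := Real.Gamma_pos_of_pos (s := (n : ℝ) / 2) (by positivity)
  have hG' := Real.Gamma_pos_of_pos (s := ((n : ℝ) + 1) / 2) (by positivity)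
  have hdup := Real.Gamma_mul_Gamma_add_half ((n : ℝ) / 2)
  have hfac : Real.Gamma (n : ℝ) = n.factorial / n := by
    have := Real.Gamma_nat_eq_factorial n
    rw [Real.Gamma_add_one hn0.ne'] at this
    rw [eq_div_iff hn0.ne', ← this]
    ring
  rw [← add_div, show 2 * ((n : ℝ) / 2) = n by ring, hfac, Real.rpow_sub (by norm_num),
    Real.rpow_one, Real.rpow_natCast] at hdup
  rw [Real.sqrt_eq_iff_mul_self_eq (by unfold Stirling.stirlingSeq; positivity) (by positivity)]
  have hs1 : √((n : ℝ) / 2) ^ n * √((n : ℝ) / 2) ^ n = (n / 2) ^ n := by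
    rw [← mul_pow, Real.mul_self_sqrt (by positivity)]
  have hs2 : Real.exp (-((n : ℝ) / 2)) * Real.exp (-(n / 2)) = 1 / Real.exp 1 ^ n := by
    rw [← Real.exp_add, ← Real.exp_nat_mul, mul_one, one_div, ← Real.exp_neg]
    congr 1
    ring
  have hs3 : √(2 * (n : ℝ)) * √((n : ℝ) / 2) = n := by
    rw [← Real.sqrt_mul (by positivity), show 2 * (n : ℝ) * (n / 2) = n ^ 2 by ring]
    exact Real.sqrt_sq hn0.le
  have hden : (√((n : ℝ) / 2) ^ n * Real.exp (-(n / 2))) *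
      (√((n : ℝ) / 2) ^ n * Real.exp (-(n / 2))) = (n / 2) ^ n * (1 / Real.exp 1 ^ n) := by
    rw [← hs1, ← hs2]
    ring
  rw [div_mul_div_comm, hden]
  have hg : Real.Gamma ((n : ℝ) / 2) =
      n.factorial / n * (2 / 2 ^ n) * √Real.pi / Real.Gamma (((n : ℝ) + 1) / 2) := by
    rw [eq_div_iff hG'.ne', hdup]
  rw [hg]
  unfold Stirling.stirlingSeq
  have hfac0 : 0 < (n.factorial : ℝ) := by exact_mod_cast n.factorial_pos
  have hsp : 0 < √Real.pi := by positivity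
  rw [div_pow, div_pow, div_div, div_mul_eq_mul_div, div_mul_div_comm,
    div_eq_div_iff (by positivity) (by positivity)]
  field_simp
  rw [mul_comm (n : ℝ) 2]
  linear_combination -hs3

lemma tendsto_inv_sqrt_nat : Tendsto (fun n : ℕ => (√(n : ℝ))⁻¹) atTop (nhds 0) :=
  (Real.tendsto_sqrt_atTop.comp tendsto_natCast_atTop_atTop).inv_tendsto_atTop

/-- Second order expansion of the logarithm along a sequence of order `1 / √n`. -/
lemma tendsto_nat_mul_log_one_add_sub {h : ℕ → ℝ} {k : ℝ}
    (hk : Tendsto (fun n : ℕ => √(n : ℝ) * h n) atTop (nhds k)) :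
    Tendsto h atTop (nhds 0) ∧
    Tendsto (fun n : ℕ => (n : ℝ) * (Real.log (1 + h n) - h n)) atTop (nhds (-(k ^ 2 / 2))) := by
  have h0 : Tendsto h atTop (nhds 0) := by
    have := tendsto_inv_sqrt_nat.mul hk
    rw [zero_mul] at this
    refine this.congr' ?_
    filter_upwards [eventually_ge_atTop 1] with n hn
    have hn0 : 0 < (n : ℝ) := by exact_mod_cast hn
    have : 0 < √(n : ℝ) := by positivity
    field_simp
  refine ⟨h0, ?_⟩
  have habs : Tendsto (fun n => |h n|) atTop (nhds 0) := by simpa using h0.abs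
  -- The cubic remainder times $n$ is at most $(\sqrt n\,h)^2\,|h|/(1-|h|)$: a convergent factor
  -- times one tending to 0.
  have hrem : Tendsto (fun n : ℕ => (n : ℝ) * (Real.log (1 + h n) - h n + h n ^ 2 / 2))
      atTop (nhds 0) := by
    have hb : Tendsto (fun n : ℕ => (√(n : ℝ) * h n) ^ 2 * (|h n| / (1 - |h n|)))
        atTop (nhds 0) := by
      have := (hk.pow 2).mul (habs.div (tendsto_const_nhds.sub habs) (by norm_num : (1 : ℝ) - 0 ≠ 0))
      simpa using this
    refine squeeze_zero_norm' ?_ hb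
    filter_upwards [habs.eventually_lt_const (show (0 : ℝ) < 1 by norm_num)] with n hn
    have hlog := Real.abs_log_sub_add_sum_range_le (x := -h n) (by rwa [abs_neg]) 2
    rw [abs_neg] at hlog
    simp only [Finset.sum_range_succ, Finset.sum_range_zero] at hlog
    have e : (0 + (-h n) ^ (0 + 1) / (((0 : ℕ) : ℝ) + 1) +
        (-h n) ^ (1 + 1) / (((1 : ℕ) : ℝ) + 1)) + Real.log (1 - -h n) =
        Real.log (1 + h n) - h n + h n ^ 2 / 2 := by
      push_cast
      rw [sub_neg_eq_add]
      ring
    rw [e] at hlog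
    rw [norm_mul, Real.norm_of_nonneg n.cast_nonneg, Real.norm_eq_abs, mul_pow,
      Real.sq_sqrt n.cast_nonneg, mul_assoc]
    gcongr
    refine hlog.trans (le_of_eq ?_)
    rw [← sq_abs (h n)]
    ring
  have := hrem.sub ((hk.pow 2).div_const 2)
  rw [zero_sub] at this
  refine this.congr fun n => ?_
  rw [mul_pow, Real.sq_sqrt n.cast_nonneg]
  ring

/-! The rescaled norm `√2 (‖y‖ / σ - √n)` -/

/-- The Gaussian density as a function of the norm of the observation. -/
def gaussianProfile (σ : ℝ) (n : ℕ) (r : ℝ) : ℝ :=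
  1 / (2 * Real.pi * σ ^ 2) ^ ((n : ℝ) / 2) * Real.exp (-r ^ 2 / (2 * σ ^ 2))

/-- The likelihood ratio as a function of the norm of the observation. -/
def ratioProfile (σ γ : ℝ) (n : ℕ) (r : ℝ) : ℝ := gaussianProfile σ n r / cauchyProfile γ n r

/-- The value of `‖y‖ / σ` at which the rescaled norm is `x`. -/
def unscale (n : ℕ) (x : ℝ) : ℝ := √n + x / √2

/-- The density of the rescaled norm under the Gaussian law. -/
def scaledDensity (n : ℕ) (x : ℝ) : ℝ :=
  if 0 < unscale n x then
    sphereArea n / (2 * Real.pi) ^ ((n : ℝ) / 2) / √2 *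
      (unscale n x ^ (n - 1) * Real.exp (-unscale n x ^ 2 / 2))
  else 0

/-- The likelihood ratio as a function of the rescaled norm, divided by its value at `0`. -/
def scaledRatio (σ γ : ℝ) (n : ℕ) (x : ℝ) : ℝ :=
  ratioProfile σ γ n (σ * unscale n x) / ratioProfile σ γ n (σ * √n)

lemma measurable_unscale (n : ℕ) : Measurable (unscale n) := by
  unfold unscale
  fun_prop

lemma measurable_ratioProfile (σ γ : ℝ) (n : ℕ) : Measurable (ratioProfile σ γ n) := by
  unfold ratioProfile gaussianProfile cauchyProfile
  fun_prop

lemma measurable_scaledRatio (σ γ : ℝ) (n : ℕ) : Measurable (scaledRatio σ γ n) :=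
  ((measurable_ratioProfile σ γ n).comp ((measurable_unscale n).const_mul σ)).div_const _

lemma gaussianProfile_pos {σ : ℝ} (hσ : 0 < σ) (n : ℕ) (r : ℝ) : 0 < gaussianProfile σ n r := by
  have := Real.pi_pos
  unfold gaussianProfile
  positivity

lemma cauchyProfile_pos {γ : ℝ} (hγ : 0 < γ) (n : ℕ) (r : ℝ) : 0 < cauchyProfile γ n r := by
  have := Real.pi_pos
  have := Real.Gamma_pos_of_pos (s := ((n : ℝ) + 1) / 2) (by positivity)
  unfold cauchyProfile
  positivity

lemma ratioProfile_pos {σ γ : ℝ} (hσ : 0 < σ) (hγ : 0 < γ) (n : ℕ) (r : ℝ) :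
    0 < ratioProfile σ γ n r :=
  div_pos (gaussianProfile_pos hσ n r) (cauchyProfile_pos hγ n r)

lemma scaledRatio_pos {σ γ : ℝ} (hσ : 0 < σ) (hγ : 0 < γ) (n : ℕ) (x : ℝ) :
    0 < scaledRatio σ γ n x :=
  div_pos (ratioProfile_pos hσ hγ n _) (ratioProfile_pos hσ hγ n _)

lemma scaledDensity_nonneg {n : ℕ} (hn : 1 ≤ n) (x : ℝ) : 0 ≤ scaledDensity n x := by
  have := sphereArea_pos hn
  have := Real.pi_pos
  unfold scaledDensity
  split_ifs with h
  · positivity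
  · rfl

lemma integral_mul_gaussianDensity {σ : ℝ} (hσ : 0 < σ) {n : ℕ} (hn : 1 ≤ n) (F : ℝ → ℝ) :
    ∫ y, F ‖y‖ * gaussianDensity σ n y = ∫ x, F (σ * unscale n x) * scaledDensity n x := by
  have hpi := Real.pi_pos
  have h := integral_radial hn (fun r => F r * gaussianProfile σ n r)
  have h1 : ∫ y, F ‖y‖ * gaussianDensity σ n y = ∫ y : Obs n, F ‖y‖ * gaussianProfile σ n ‖y‖ := rfl
  rw [h1, h, ← integral_indicator measurableSet_Ioi]
  -- Extension by zero to the whole line makes the scaling and translation rules of Lebesgue measure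
  -- applicable.
  set H := (Set.Ioi (0 : ℝ)).indicator
    (fun r => sphereArea n * r ^ (n - 1) * (F r * gaussianProfile σ n r)) with hH
  have e1 : ∫ r, H r = σ * ∫ s, H (σ * s) := by
    rw [Measure.integral_comp_mul_left, abs_of_pos (inv_pos.2 hσ), smul_eq_mul,
      mul_inv_cancel_left₀ hσ.ne']
  have e2 : ∫ s, H (σ * s) = ∫ t, H (σ * (√n + t)) :=
    (integral_add_left_eq_self (fun s => H (σ * s)) (√(n : ℝ))).symm
  have hs2 : 0 < √(2 : ℝ) := by positivity
  have e3 : ∫ t, H (σ * (√n + t)) = 1 / √2 * ∫ x, H (σ * unscale n x) := by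
    have := Measure.integral_comp_div (fun t => H (σ * (√n + t))) (√(2 : ℝ))
    rw [abs_of_pos hs2, smul_eq_mul] at this
    change _ = 1 / √2 * ∫ x, H (σ * (√n + x / √2))
    rw [this]
    field_simp
  rw [e1, e2, e3, ← mul_assoc, ← integral_const_mul]
  refine integral_congr_ae (ae_of_all _ fun x => ?_)
  simp only [hH, scaledDensity]
  by_cases hx : 0 < unscale n x
  · rw [if_pos hx, Set.indicator_of_mem (Set.mem_Ioi.2 (by positivity)), gaussianProfile,
      Real.mul_rpow (by positivity) (by positivity)]
    have hσn : (σ ^ 2) ^ ((n : ℝ) / 2) = σ ^ (n - 1) * σ := by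
      rw [← pow_succ, Nat.sub_add_cancel hn, ← Real.rpow_natCast _ 2, ← Real.rpow_mul hσ.le,
        ← Real.rpow_natCast _ n]
      congr 1
      push_cast
      ring
    have hexp : -(σ * unscale n x) ^ 2 / (2 * σ ^ 2) = -unscale n x ^ 2 / 2 := by
      field_simp
    rw [hσn, hexp, mul_pow]
    have : 0 < (2 * Real.pi) ^ ((n : ℝ) / 2) := by positivity
    field_simp
  · rw [if_neg hx, Set.indicator_of_notMem, mul_zero, mul_zero]
    rw [Set.mem_Ioi, not_lt]
    exact mul_nonpos_of_nonneg_of_nonpos hσ.le (not_lt.1 hx)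

lemma integral_scaledDensity {n : ℕ} (hn : 1 ≤ n) : ∫ x, scaledDensity n x = 1 := by
  have h := integral_mul_gaussianDensity one_pos hn (fun _ => 1)
  simp only [one_mul] at h
  rw [← h, integral_gaussianDensity one_pos]

lemma integrable_scaledDensity {n : ℕ} (hn : 1 ≤ n) : Integrable (scaledDensity n) :=
  Integrable.of_integral_ne_zero (by rw [integral_scaledDensity hn]; exact one_ne_zero)

lemma unscale_sq (n : ℕ) (x : ℝ) : unscale n x ^ 2 = n + 2 * (√n * (x / √2)) + x ^ 2 / 2 := by
  rw [unscale, add_sq, Real.sq_sqrt n.cast_nonneg, div_pow, Real.sq_sqrt (by norm_num)]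
  ring

/-- With $h=x/\sqrt{2n}$ the exponent is $(n-1)\log(1+h)-nh-x^2/4$ up to constants. The quadratic
term of the logarithm supplies the other $-x^2/4$, and Stirling the factor $1/\sqrt{2\pi}$. -/
lemma tendsto_scaledDensity (x : ℝ) :
    Tendsto (fun n => scaledDensity n x) atTop (nhds (gaussianPDFReal 0 1 x)) := by
  have hpi := Real.pi_pos
  have hs2 : 0 < √(2 : ℝ) := by positivity
  have hconst : Tendsto (fun n : ℕ =>
      √((n : ℝ) / 2) ^ (n - 1) * Real.exp (-(n / 2)) / Real.Gamma ((n : ℝ) / 2))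
      atTop (nhds (1 / √(2 * Real.pi))) := by
    refine (tendsto_Gamma_ratio.div tendsto_Gamma_stirling (by positivity)).congr' ?_
    filter_upwards [eventually_ge_atTop 1] with n hn
    have hn0 : 0 < (n : ℝ) := by exact_mod_cast hn
    have hG' := Real.Gamma_pos_of_pos (s := ((n : ℝ) + 1) / 2) (by positivity)
    have : √((n : ℝ) / 2) ^ n = √((n : ℝ) / 2) ^ (n - 1) * √((n : ℝ) / 2) := by
      rw [← pow_succ, Nat.sub_add_cancel hn]
    rw [Pi.div_apply, this]
    have hsn : 0 < √((n : ℝ) / 2) := by positivity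
    have hE := Real.exp_pos (-((n : ℝ) / 2))
    generalize Real.exp (-((n : ℝ) / 2)) = E at *
    field_simp
  set h : ℕ → ℝ := fun n => x / √2 / √n with hh
  have hk : Tendsto (fun n : ℕ => √(n : ℝ) * h n) atTop (nhds (x / √2)) := by
    refine tendsto_const_nhds.congr' ?_
    filter_upwards [eventually_ge_atTop 1] with n hn
    have hn0 : 0 < (n : ℝ) := by exact_mod_cast hn
    have : 0 < √(n : ℝ) := by positivity
    simp only [hh]
    field_simp
  obtain ⟨h0, hlog⟩ := tendsto_nat_mul_log_one_add_sub hk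
  have hlog0 : Tendsto (fun n => Real.log (1 + h n)) atTop (nhds 0) := by
    have := (tendsto_const_nhds (x := (1 : ℝ))).add h0
    rw [add_zero] at this
    simpa using this.log one_ne_zero
  have hexp := ((hlog.sub hlog0).sub_const (x ^ 2 / 4)).rexp
  have hprod := hconst.mul hexp
  have elim : 1 / √(2 * Real.pi) * Real.exp (-((x / √2) ^ 2 / 2) - 0 - x ^ 2 / 4) =
      gaussianPDFReal 0 1 x := by
    rw [gaussianPDFReal, div_pow, Real.sq_sqrt (by norm_num)]
    simp only [NNReal.coe_one, mul_one, sub_zero, one_div]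
    congr 2
    ring
  rw [elim] at hprod
  refine hprod.congr' ?_
  filter_upwards [eventually_ge_atTop 1, h0.eventually_const_lt (show (-1 : ℝ) < 0 by norm_num)]
    with n hn hhn
  have hn0 : 0 < (n : ℝ) := by exact_mod_cast hn
  have hsn : 0 < √(n : ℝ) := by positivity
  have hu : unscale n x = √n * (1 + h n) := by
    simp only [hh, unscale]
    field_simp
  have h1 : 0 < 1 + h n := by linarith
  have hupos : 0 < unscale n x := by rw [hu]; positivity
  have hG := Real.Gamma_pos_of_pos (s := (n : ℝ) / 2) (by positivity)
  rw [scaledDensity, if_pos hupos]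
  have hpow : unscale n x ^ (n - 1) =
      √n ^ (n - 1) * Real.exp (((n : ℝ) - 1) * Real.log (1 + h n)) := by
    rw [hu, mul_pow, ← Nat.cast_pred hn, Real.exp_nat_mul, Real.exp_log h1]
  have hsq : -unscale n x ^ 2 / 2 = -(n / 2) - n * h n - x ^ 2 / 4 := by
    rw [unscale_sq]
    have : (n : ℝ) * h n = √n * (x / √2) := by
      simp only [hh]
      rw [mul_div_assoc', div_eq_iff hsn.ne']
      linear_combination -(x / √2) * Real.mul_self_sqrt hn0.le
    rw [this]
    ring
  have hC : sphereArea n / (2 * Real.pi) ^ ((n : ℝ) / 2) / √2 * √n ^ (n - 1) =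
      √((n : ℝ) / 2) ^ (n - 1) / Real.Gamma ((n : ℝ) / 2) := by
    have e2 : (2 : ℝ) ^ ((n : ℝ) / 2) = √2 ^ (n - 1) * √2 := by
      rw [← pow_succ, Nat.sub_add_cancel hn, Real.sqrt_eq_rpow, ← Real.rpow_natCast _ n,
        ← Real.rpow_mul (by norm_num)]
      congr 1
      ring
    rw [sphereArea, Real.mul_rpow (by norm_num) hpi.le, e2, Real.sqrt_div hn0.le, div_pow]
    have : 0 < Real.pi ^ ((n : ℝ) / 2) := by positivity
    field_simp
    rw [Real.sq_sqrt (by norm_num)]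
  have hE : Real.exp ((n : ℝ) * (Real.log (1 + h n) - h n) - Real.log (1 + h n) - x ^ 2 / 4) *
      Real.exp (-(n / 2)) =
      Real.exp (((n : ℝ) - 1) * Real.log (1 + h n)) * Real.exp (-unscale n x ^ 2 / 2) := by
    rw [← Real.exp_add, ← Real.exp_add, hsq]
    congr 1
    ring
  rw [hpow]
  calc _ = √((n : ℝ) / 2) ^ (n - 1) / Real.Gamma ((n : ℝ) / 2) *
        (Real.exp ((n : ℝ) * (Real.log (1 + h n) - h n) - Real.log (1 + h n) - x ^ 2 / 4) *
          Real.exp (-(n / 2))) := by ring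
    _ = _ := by
      rw [hE, ← hC]
      ring

/-- Dividing by the value at $\sigma\sqrt n$ cancels all normalising constants; only the excess of
the squared norm over $n$ remains. -/
lemma scaledRatio_eq {σ γ : ℝ} (hσ : 0 < σ) (hγ : 0 < γ) (n : ℕ) (x : ℝ) :
    0 < 1 + (unscale n x ^ 2 - n) / (n + γ ^ 2 / σ ^ 2) ∧
    scaledRatio σ γ n x = Real.exp (-(unscale n x ^ 2 - n) / 2 + ((n : ℝ) + 1) / 2 *
      Real.log (1 + (unscale n x ^ 2 - n) / (n + γ ^ 2 / σ ^ 2))) := by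
  have hpi := Real.pi_pos
  have hG := Real.Gamma_pos_of_pos (s := ((n : ℝ) + 1) / 2) (by positivity)
  have hnn : (0 : ℝ) ≤ n := n.cast_nonneg
  have hq : 1 + (unscale n x ^ 2 - n) / (n + γ ^ 2 / σ ^ 2) =
      (1 + (σ * unscale n x) ^ 2 / γ ^ 2) / (1 + (σ * √n) ^ 2 / γ ^ 2) := by
    rw [mul_pow, mul_pow, Real.sq_sqrt hnn]
    have h1 : 0 < n + γ ^ 2 / σ ^ 2 := by positivity
    have h2 : 0 < n * σ ^ 2 + γ ^ 2 := by positivity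
    have h3 : 0 < γ ^ 2 + σ ^ 2 * n := by positivity
    field_simp
    ring
  have hpos : 0 < 1 + (unscale n x ^ 2 - n) / (n + γ ^ 2 / σ ^ 2) := by
    rw [hq]
    positivity
  refine ⟨hpos, ?_⟩
  rw [Real.exp_add, mul_comm (((n : ℝ) + 1) / 2), ← Real.rpow_def_of_pos hpos, hq,
    Real.div_rpow (by positivity) (by positivity)]
  have hexp : Real.exp (-(unscale n x ^ 2 - n) / 2) =
      Real.exp (-(σ * unscale n x) ^ 2 / (2 * σ ^ 2)) /
        Real.exp (-(σ * √n) ^ 2 / (2 * σ ^ 2)) := by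
    rw [← Real.exp_sub, mul_pow, mul_pow, Real.sq_sqrt hnn]
    congr 1
    field_simp
    ring
  rw [hexp, scaledRatio, ratioProfile, ratioProfile, gaussianProfile, gaussianProfile,
    cauchyProfile, cauchyProfile]
  have p1 : 0 < (1 + (σ * unscale n x) ^ 2 / γ ^ 2) ^ (((n : ℝ) + 1) / 2) := by positivity
  have p2 : 0 < (1 + (σ * √n) ^ 2 / γ ^ 2) ^ (((n : ℝ) + 1) / 2) := by positivity
  have p3 : 0 < Real.pi ^ (((n : ℝ) + 1) / 2) := by positivity
  have p4 : 0 < (2 * Real.pi * σ ^ 2) ^ ((n : ℝ) / 2) := by positivity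
  generalize (1 + (σ * unscale n x) ^ 2 / γ ^ 2) ^ (((n : ℝ) + 1) / 2) = A at *
  generalize (1 + (σ * √n) ^ 2 / γ ^ 2) ^ (((n : ℝ) + 1) / 2) = B at *
  have p5 := Real.exp_pos (-(σ * √n) ^ 2 / (2 * σ ^ 2))
  generalize Real.exp (-(σ * √n) ^ 2 / (2 * σ ^ 2)) = E at *
  field_simp

/-- The radius $\sigma\sqrt n$ is critical to leading order: the linear terms cancel and the
quadratic term of the logarithm gives $-x^2/2$. -/
lemma tendsto_scaledRatio {σ γ : ℝ} (hσ : 0 < σ) (hγ : 0 < γ) (x : ℝ) :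
    Tendsto (fun n => scaledRatio σ γ n x) atTop (nhds (Real.exp (-(x ^ 2 / 2)))) := by
  set v := γ ^ 2 / σ ^ 2 with hv
  have hv0 : 0 < v := by positivity
  set h : ℕ → ℝ := fun n => (unscale n x ^ 2 - n) / (n + v) with hh
  have hk : Tendsto (fun n : ℕ => √(n : ℝ) * h n) atTop (nhds (2 * (x / √2))) := by
    have := (tendsto_natCast_div_add_atTop (𝕜 := ℝ) v).mul
      ((tendsto_inv_sqrt_nat.const_mul (x ^ 2 / 2)).const_add (2 * (x / √2)))
    rw [mul_zero, add_zero, one_mul] at this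
    refine this.congr' ?_
    filter_upwards [eventually_ge_atTop 1] with n hn
    have hn0 : 0 < (n : ℝ) := by exact_mod_cast hn
    have hsn : 0 < √(n : ℝ) := by positivity
    have hss := Real.sq_sqrt hn0.le
    simp only [hh, unscale_sq]
    have : (n : ℝ) * (2 * (x / √2) + x ^ 2 / 2 * (√(n : ℝ))⁻¹) =
        √n * (2 * (√n * (x / √2)) + x ^ 2 / 2) := by
      have hns : (n : ℝ) * (√(n : ℝ))⁻¹ = √n := by
        rw [← div_eq_mul_inv, Real.div_sqrt]
      linear_combination (-(2 * (x / √2))) * hss + x ^ 2 / 2 * hns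
    rw [div_mul_eq_mul_div, this]
    ring
  obtain ⟨h0, hlog⟩ := tendsto_nat_mul_log_one_add_sub hk
  have hlog0 : Tendsto (fun n => Real.log (1 + h n)) atTop (nhds 0) := by
    have := (tendsto_const_nhds (x := (1 : ℝ))).add h0
    rw [add_zero] at this
    simpa using this.log one_ne_zero
  have hexp := (((hlog.div_const 2).add (hlog0.div_const 2)).sub (h0.const_mul (v / 2))).rexp
  have elim : -((2 * (x / √2)) ^ 2 / 2) / 2 + 0 / 2 - v / 2 * 0 = -(x ^ 2 / 2) := by
    rw [mul_pow, div_pow, Real.sq_sqrt (by norm_num)]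
    ring
  rw [elim] at hexp
  refine hexp.congr fun n => ?_
  rw [(scaledRatio_eq hσ hγ n x).2]
  have hD : unscale n x ^ 2 - n = h n * (n + v) := by
    simp only [hh]
    rw [div_mul_cancel₀]
    positivity
  congr 1
  change _ = -(unscale n x ^ 2 - n) / 2 + ((n : ℝ) + 1) / 2 * Real.log (1 + h n)
  rw [hD]
  ring

/-- Stirling for $\Gamma(\frac{n+1}2)$ gives the order $\sqrt n$; the exponential constant is the
limit of $(1+v/n)^{n/2}$ with $v=\gamma^2/\sigma^2$. -/
lemma tendsto_ratioProfile_div_sqrt {σ γ : ℝ} (hσ : 0 < σ) (hγ : 0 < γ) :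
    Tendsto (fun n : ℕ => ratioProfile σ γ n (σ * √n) / √n) atTop
      (nhds (σ / γ / √2 * Real.exp (γ ^ 2 / (2 * σ ^ 2)))) := by
  have hpi := Real.pi_pos
  set v := γ ^ 2 / σ ^ 2 with hv
  have hv0 : 0 < v := by positivity
  have h1 : Tendsto (fun n : ℕ => √((1 + v / n) ^ n) * √(1 + v / n)) atTop
      (nhds (Real.exp (v / 2))) := by
    have ha := (Real.tendsto_one_add_div_pow_exp v).sqrt
    have hb : Tendsto (fun n : ℕ => √(1 + v / (n : ℝ))) atTop (nhds √(1 + 0)) :=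
      ((tendsto_const_div_atTop_nhds_zero_nat v).const_add 1).sqrt
    have := ha.mul hb
    rwa [add_zero, Real.sqrt_one, mul_one, ← Real.exp_half] at this
  have h2 := (tendsto_const_nhds (x := √Real.pi)).div tendsto_Gamma_stirling (by positivity)
  have h3 := (h2.mul_const (σ / γ)).mul h1
  have elim : √Real.pi / √(2 * Real.pi) * (σ / γ) * Real.exp (v / 2) =
      σ / γ / √2 * Real.exp (γ ^ 2 / (2 * σ ^ 2)) := by
    rw [Real.sqrt_mul (by norm_num), show v / 2 = γ ^ 2 / (2 * σ ^ 2) by rw [hv]; field_simp]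
    have : 0 < √Real.pi := by positivity
    field_simp
  rw [elim] at h3
  refine h3.congr' ?_
  filter_upwards [eventually_ge_atTop 1] with n hn
  have hn0 : 0 < (n : ℝ) := by exact_mod_cast hn
  have hsn : 0 < √(n : ℝ) := by positivity
  have hG := Real.Gamma_pos_of_pos (s := ((n : ℝ) + 1) / 2) (by positivity)
  have hsp : 0 < √Real.pi := by positivity
  have hs2 : 0 < √(2 : ℝ) := by positivity
  have hbase : (1 + (σ * √n) ^ 2 / γ ^ 2) ^ (((n : ℝ) + 1) / 2) =
      (σ / γ * √n) ^ (n + 1) * (√((1 + v / n) ^ n) * √(1 + v / n)) := by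
    have hw : 0 < 1 + v / n := by positivity
    have e : 1 + (σ * √n) ^ 2 / γ ^ 2 = (σ / γ * √n * √(1 + v / n)) ^ 2 := by
      rw [mul_pow, mul_pow, mul_pow, Real.sq_sqrt hn0.le, Real.sq_sqrt hw.le, hv]
      field_simp
      ring
    rw [e, ← Real.rpow_natCast _ 2, ← Real.rpow_mul (by positivity),
      show ((2 : ℕ) : ℝ) * (((n : ℝ) + 1) / 2) = ((n + 1 : ℕ) : ℝ) by push_cast; ring,
      Real.rpow_natCast, mul_pow _ (√(1 + v / n)), pow_succ (√(1 + v / n)),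
      Real.sqrt_eq_rpow ((1 + v / n) ^ n), ← Real.rpow_natCast (1 + v / n) n,
      ← Real.rpow_mul hw.le, mul_comm (n : ℝ) (1 / 2), Real.rpow_mul hw.le, ← Real.sqrt_eq_rpow,
      Real.rpow_natCast]
  have hnorm : (2 * Real.pi * σ ^ 2) ^ ((n : ℝ) / 2) = (√2 * √Real.pi * σ) ^ n := by
    have : 2 * Real.pi * σ ^ 2 = (√2 * √Real.pi * σ) ^ 2 := by
      rw [mul_pow, mul_pow, Real.sq_sqrt (by norm_num), Real.sq_sqrt hpi.le]
    rw [this, ← Real.rpow_natCast _ 2, ← Real.rpow_mul (by positivity), ← Real.rpow_natCast _ n]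
    congr 1
    push_cast
    ring
  have hpin : Real.pi ^ (((n : ℝ) + 1) / 2) = √Real.pi ^ n * √Real.pi := by
    rw [← pow_succ, Real.sqrt_eq_rpow, ← Real.rpow_natCast _ (n + 1), ← Real.rpow_mul hpi.le]
    congr 1
    push_cast
    ring
  have hexp : -(σ * √n) ^ 2 / (2 * σ ^ 2) = -(n / 2 : ℝ) := by
    rw [mul_pow, Real.sq_sqrt hn0.le]
    field_simp
  simp only [ratioProfile, gaussianProfile, cauchyProfile, Pi.div_apply]
  rw [hbase, hnorm, hpin, hexp, Real.sqrt_div hn0.le]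
  have hw1 : 0 < √((1 + v / n) ^ n) * √(1 + v / n) := by positivity
  generalize √((1 + v / n) ^ n) * √(1 + v / n) = W at *
  have hE := Real.exp_pos (-(n / 2 : ℝ))
  generalize Real.exp (-(n / 2 : ℝ)) = E at *
  rw [div_pow, mul_pow _ (√(n : ℝ)), div_pow, mul_pow, mul_pow]
  field_simp
  ring

/-! ### Limits of integrals against converging densities -/

/-- Scheffé's lemma. -/
lemma tendsto_integral_abs_sub {α : Type*} [MeasurableSpace α] {μ : Measure α}
    {g : ℕ → α → ℝ} {φ : α → ℝ} (hg : ∀ᶠ n in atTop, Integrable (g n) μ)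
    (hg0 : ∀ᶠ n in atTop, ∀ x, 0 ≤ g n x) (hφ : Integrable φ μ) (hφ0 : ∀ x, 0 ≤ φ x)
    (hint : ∀ᶠ n in atTop, ∫ x, g n x ∂μ = ∫ x, φ x ∂μ)
    (hlim : ∀ x, Tendsto (fun n => g n x) atTop (nhds (φ x))) :
    Tendsto (fun n => ∫ x, |g n x - φ x| ∂μ) atTop (nhds 0) := by
  -- The positive part of $\varphi-g_n$ is dominated by $\varphi$, and equality of the integrals
  -- makes the $L^1$ distance twice its integral.
  have hdom : Tendsto (fun n => ∫ x, max (φ x - g n x) 0 ∂μ) atTop (nhds (∫ _, (0 : ℝ) ∂μ)) := by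
    refine tendsto_integral_filter_of_dominated_convergence φ ?_ ?_ hφ ?_
    · filter_upwards [hg] with n hn
      exact (hφ.sub hn).aestronglyMeasurable.sup aestronglyMeasurable_const
    · filter_upwards [hg0] with n hn
      refine ae_of_all _ fun x => ?_
      rw [Real.norm_of_nonneg (le_max_right _ _)]
      exact max_le (by linarith [hn x]) (hφ0 x)
    · refine ae_of_all _ fun x => ?_
      have := ((tendsto_const_nhds (x := φ x)).sub (hlim x)).max (tendsto_const_nhds (x := (0 : ℝ)))
      simpa using this
  rw [integral_zero] at hdom
  have := hdom.const_mul 2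
  rw [mul_zero] at this
  refine this.congr' ?_
  filter_upwards [hg, hint] with n h1 h2
  have h3 : Integrable (fun x => max (φ x - g n x) 0) μ := (hφ.sub h1).pos_part
  have e : (fun x => |g n x - φ x|) = fun x => (g n x - φ x) + 2 * max (φ x - g n x) 0 := by
    funext x
    rcases le_total (φ x) (g n x) with h | h
    · rw [abs_of_nonneg (sub_nonneg.2 h), max_eq_right (by linarith)]
      ring
    · rw [abs_of_nonpos (sub_nonpos.2 h), max_eq_left (by linarith)]
      ring
  have h4 : Integrable (fun x => g n x - φ x) μ := h1.sub hφ
  rw [e, integral_add h4 (h3.const_mul 2), integral_sub h1 hφ, h2, sub_self, zero_add,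
    integral_const_mul]

/-- Convergence of integrals of bounded functions against densities that converge pointwise. -/
lemma tendsto_integral_mul_of_tendsto_density {α : Type*} [MeasurableSpace α] {μ : Measure α}
    {g : ℕ → α → ℝ} {φ : α → ℝ} (hg : ∀ᶠ n in atTop, Integrable (g n) μ)
    (hg0 : ∀ᶠ n in atTop, ∀ x, 0 ≤ g n x) (hφ : Integrable φ μ) (hφ0 : ∀ x, 0 ≤ φ x)
    (hint : ∀ᶠ n in atTop, ∫ x, g n x ∂μ = ∫ x, φ x ∂μ)
    (hlim : ∀ x, Tendsto (fun n => g n x) atTop (nhds (φ x)))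
    {F : ℕ → α → ℝ} {F' : α → ℝ} {K : ℝ} (hF : ∀ᶠ n in atTop, AEStronglyMeasurable (F n) μ)
    (hK : ∀ᶠ n in atTop, ∀ x, |F n x| ≤ K)
    (hFlim : ∀ᵐ x ∂μ, Tendsto (fun n => F n x) atTop (nhds (F' x))) :
    Tendsto (fun n => ∫ x, F n x * g n x ∂μ) atTop (nhds (∫ x, F' x * φ x ∂μ)) := by
  have h1 : Tendsto (fun n => ∫ x, F n x * φ x ∂μ) atTop (nhds (∫ x, F' x * φ x ∂μ)) := by
    refine tendsto_integral_filter_of_dominated_convergence (fun x => K * φ x) ?_ ?_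
      (hφ.const_mul K) ?_
    · filter_upwards [hF] with n hn
      exact hn.mul hφ.aestronglyMeasurable
    · filter_upwards [hK] with n hn
      refine ae_of_all _ fun x => ?_
      rw [norm_mul, Real.norm_eq_abs, Real.norm_of_nonneg (hφ0 x)]
      exact mul_le_mul_of_nonneg_right (hn x) (hφ0 x)
    · filter_upwards [hFlim] with x hx
      exact hx.mul_const _
  have h2 : Tendsto (fun n => ∫ x, F n x * (g n x - φ x) ∂μ) atTop (nhds 0) := by
    have hL1 := (tendsto_integral_abs_sub hg hg0 hφ hφ0 hint hlim).const_mul K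
    rw [mul_zero] at hL1
    refine squeeze_zero_norm' ?_ hL1
    filter_upwards [hg, hK] with n hn1 hn2
    rw [← integral_const_mul]
    refine norm_integral_le_of_norm_le ((hn1.sub hφ).abs.const_mul K) (ae_of_all _ fun x => ?_)
    rw [norm_mul, Real.norm_eq_abs, Real.norm_eq_abs]
    exact mul_le_mul_of_nonneg_right (hn2 x) (abs_nonneg _)
  have h3 := h2.add h1
  rw [zero_add] at h3
  refine h3.congr' ?_
  filter_upwards [hg, hF, hK] with n hn1 hn2 hn3
  have i1 : Integrable (fun x => F n x * (g n x - φ x)) μ :=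
    (hn1.sub hφ).bdd_mul hn2 (ae_of_all _ hn3)
  have i2 : Integrable (fun x => F n x * φ x) μ := hφ.bdd_mul hn2 (ae_of_all _ hn3)
  rw [← integral_add i1 i2]
  congr 1
  funext x
  ring

lemma tendsto_integral_mul_scaledDensity {F : ℕ → ℝ → ℝ} {F' : ℝ → ℝ} {K : ℝ}
    (hF : ∀ n, Measurable (F n)) (hK : ∀ᶠ n in atTop, ∀ x, |F n x| ≤ K)
    (hlim : ∀ᵐ x, Tendsto (fun n => F n x) atTop (nhds (F' x))) :
    Tendsto (fun n => ∫ x, F n x * scaledDensity n x) atTop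
      (nhds (∫ x, F' x * gaussianPDFReal 0 1 x)) := by
  refine tendsto_integral_mul_of_tendsto_density ?_ ?_ (integrable_gaussianPDFReal 0 1)
    (gaussianPDFReal_nonneg 0 1) ?_ tendsto_scaledDensity
    (Eventually.of_forall fun n => (hF n).aestronglyMeasurable) hK hlim
  · filter_upwards [eventually_ge_atTop 1] with n hn using integrable_scaledDensity hn
  · filter_upwards [eventually_ge_atTop 1] with n hn using scaledDensity_nonneg hn
  · filter_upwards [eventually_ge_atTop 1] with n hn
    rw [integral_scaledDensity hn, integral_gaussianPDFReal_eq_one 0 one_ne_zero]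

/-! The standard Gaussian law -/

lemma gaussianReal_real_Iio_neg (q : ℝ) :
    (gaussianReal 0 1).real (Set.Iio (-q)) = gaussianQ q := by
  have h : (gaussianReal 0 1).map (fun x => -x) = gaussianReal 0 1 := by
    rw [gaussianReal_map_neg, neg_zero]
  rw [gaussianQ]
  nth_rewrite 1 [← h]
  rw [map_measureReal_apply measurable_neg measurableSet_Iio]
  congr 1
  ext x
  simp

/-- Only that $p$ is in the range of $Q$ matters, which is the intermediate value theorem for the
cdf. -/
lemma gaussianQ_gaussianQInv {p : ℝ} (h0 : 0 < p) (h1 : p < 1) :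
    gaussianQ (gaussianQInv p) = p := by
  have : NullSingletonClass (gaussianReal 0 1) := nullSingletonClass_gaussianReal one_ne_zero
  obtain ⟨x, hx⟩ := exists_cdf_eq (gaussianReal 0 1) (ε := 1 - p) (by linarith) (by linarith)
  refine Function.invFun_eq ⟨x, ?_⟩
  rw [cdf_eq_real] at hx
  rw [gaussianQ, ← Set.compl_Iic, probReal_compl_eq_one_sub measurableSet_Iic, hx]
  ring

lemma gaussianReal_real_Icc {q : ℝ} (hq : 0 ≤ q) :
    (gaussianReal 0 1).real (Set.Icc (-q) q) = 1 - 2 * gaussianQ q := by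
  have hc : (Set.Icc (-q) q)ᶜ = Set.Iio (-q) ∪ Set.Ioi q := by
    ext x
    simp only [Set.mem_compl_iff, Set.mem_Icc, not_and_or, not_le, Set.mem_union, Set.mem_Iio,
      Set.mem_Ioi]
  have h := probReal_compl_eq_one_sub (μ := gaussianReal 0 1) (measurableSet_Icc (a := -q) (b := q))
  rw [hc, measureReal_union _ measurableSet_Ioi, gaussianReal_real_Iio_neg] at h
  · rw [gaussianQ] at *
    linarith
  · rw [Set.disjoint_left]
    intro x hx hx'
    have hx : x < -q := hx
    have hx' : q < x := hx'
    linarith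

/-- For $q\le0$ the two symmetric tails cover the line up to the null set $\{0\}$, forcing
$2Q(q)\ge1$. -/
lemma pos_of_gaussianQ_lt {q : ℝ} (h : gaussianQ q < 1 / 2) : 0 < q := by
  by_contra! hq
  have h1 := gaussianReal_real_Iio_neg q
  have hu : (Set.univ : Set ℝ) ⊆ (Set.Iio (-q) ∪ Set.Ioi q) ∪ {0} := by
    intro x _
    rcases lt_trichotomy x 0 with hx | hx | hx
    · exact Or.inl (Or.inl (lt_of_lt_of_le hx (by linarith)))
    · exact Or.inr hx
    · exact Or.inl (Or.inr (lt_of_le_of_lt hq hx))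
  have : NullSingletonClass (gaussianReal 0 1) := nullSingletonClass_gaussianReal one_ne_zero
  have h2 := (measureReal_mono (μ := gaussianReal 0 1) hu).trans (measureReal_union_le _ _)
  have h3 := measureReal_union_le (μ := gaussianReal 0 1) (Set.Iio (-q)) (Set.Ioi q)
  have h4 : (gaussianReal 0 1).real {(0 : ℝ)} = 0 := by simp [Measure.real]
  rw [probReal_univ] at h2
  rw [gaussianQ] at *
  linarith

lemma gaussianReal_real_Icc_lt {p q : ℝ} (hp : 0 ≤ p) (hpq : p < q) :
    (gaussianReal 0 1).real (Set.Icc (-p) p) < (gaussianReal 0 1).real (Set.Icc (-q) q) := by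
  have hsub : Set.Icc (-p) p ∪ Set.Ioc p q ⊆ Set.Icc (-q) q := by
    rintro x (hx | hx)
    · exact ⟨by linarith [hx.1], by linarith [hx.2]⟩
    · exact ⟨by linarith [hx.1], hx.2⟩
  have hdisj : Disjoint (Set.Icc (-p) p) (Set.Ioc p q) := by
    rw [Set.disjoint_left]
    intro x hx hx'
    exact absurd hx.2 (not_le.2 hx'.1)
  have h := measureReal_mono (μ := gaussianReal 0 1) hsub
  rw [measureReal_union hdisj measurableSet_Ioc] at h
  have hpos : 0 < (gaussianReal 0 1).real (Set.Ioc p q) := by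
    refine measureReal_nonneg.lt_of_ne' fun h0 => ?_
    rw [measureReal_eq_zero_iff] at h0
    have := gaussianReal_absolutelyContinuous' 0 one_ne_zero h0
    rw [Real.volume_Ioc, ENNReal.ofReal_eq_zero] at this
    linarith
  linarith

lemma exp_neg_half_sq_le_iff {p x : ℝ} (hp : 0 ≤ p) :
    Real.exp (-(p ^ 2 / 2)) ≤ Real.exp (-(x ^ 2 / 2)) ↔ x ∈ Set.Icc (-p) p := by
  rw [Real.exp_le_exp, Set.mem_Icc, ← abs_le, ← sq_le_sq₀ (abs_nonneg x) hp, sq_abs]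
  constructor <;> intro h <;> linarith

lemma ae_exp_neg_half_sq_ne (p : ℝ) : ∀ᵐ x : ℝ, Real.exp (-(x ^ 2 / 2)) ≠ Real.exp (-(p ^ 2 / 2)) := by
  have hfin : ({p, -p} : Set ℝ).Finite := Set.toFinite _
  refine measure_mono_null (fun x hx => ?_) (hfin.measure_zero volume)
  have hx : ¬ Real.exp (-(x ^ 2 / 2)) ≠ Real.exp (-(p ^ 2 / 2)) := hx
  rw [not_not, Real.exp_eq_exp] at hx
  have : x ^ 2 = p ^ 2 := by linarith
  exact sq_eq_sq_iff_eq_or_eq_neg.1 this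

/-- Off the boundary $a=b$ the test eventually has a constant outcome; in the applications the
boundary is the null set $\{\pm p\}$. -/
lemma tendsto_ite_le {u θ : ℕ → ℝ} {a b : ℝ} {f : ℕ → ℝ} {c : ℝ}
    (hu : Tendsto u atTop (nhds a)) (hθ : Tendsto θ atTop (nhds b)) (hab : a ≠ b)
    (hf : Tendsto f atTop (nhds c)) :
    Tendsto (fun n => if θ n ≤ u n then f n else 0) atTop (nhds (if b ≤ a then c else 0)) := by
  rcases lt_or_gt_of_ne hab with h | h
  · rw [if_neg (not_le.2 h)]
    refine tendsto_const_nhds.congr' ?_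
    filter_upwards [hu.eventually_lt hθ h] with n hn
    rw [if_neg (not_le.2 hn)]
  · rw [if_pos h.le]
    refine hf.congr' ?_
    filter_upwards [hθ.eventually_lt hu h] with n hn
    rw [if_pos hn.le]

lemma integral_ite_exp_mul {p : ℝ} (hp : 0 ≤ p) :
    ∫ x, (if Real.exp (-(p ^ 2 / 2)) ≤ Real.exp (-(x ^ 2 / 2)) then (1 : ℝ) else 0) *
      gaussianPDFReal 0 1 x = (gaussianReal 0 1).real (Set.Icc (-p) p) := by
  rw [Measure.real, gaussianReal_apply_eq_integral 0 one_ne_zero,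
    ENNReal.toReal_ofReal (integral_nonneg fun x => gaussianPDFReal_nonneg 0 1 x),
    ← integral_indicator measurableSet_Icc]
  refine integral_congr_ae (ae_of_all _ fun x => ?_)
  simp only [exp_neg_half_sq_le_iff hp]
  by_cases hx : x ∈ Set.Icc (-p) p
  · rw [if_pos hx, Set.indicator_of_mem hx, one_mul]
  · rw [if_neg hx, Set.indicator_of_notMem hx, zero_mul]

/-- The limiting reciprocal ratio $e^{x^2/2}$ cancels the normal density to a constant, so the
integral is a length. -/
lemma integral_ite_exp_inv_mul {p : ℝ} (hp : 0 ≤ p) :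
    ∫ x, (if Real.exp (-(p ^ 2 / 2)) ≤ Real.exp (-(x ^ 2 / 2)) then
      (Real.exp (-(x ^ 2 / 2)))⁻¹ else 0) * gaussianPDFReal 0 1 x = 2 * p / √(2 * Real.pi) := by
  have e : ∀ x : ℝ, (if Real.exp (-(p ^ 2 / 2)) ≤ Real.exp (-(x ^ 2 / 2)) then
      (Real.exp (-(x ^ 2 / 2)))⁻¹ else 0) * gaussianPDFReal 0 1 x =
      (Set.Icc (-p) p).indicator (fun _ => 1 / √(2 * Real.pi)) x := by
    intro x
    simp only [exp_neg_half_sq_le_iff hp]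
    by_cases hx : x ∈ Set.Icc (-p) p
    · rw [if_pos hx, Set.indicator_of_mem hx, gaussianPDFReal]
      simp only [NNReal.coe_one, mul_one, sub_zero, one_div]
      rw [neg_div]
      have := Real.exp_pos (-(x ^ 2 / 2))
      field_simp
    · rw [if_neg hx, Set.indicator_of_notMem hx, zero_mul]
  simp only [e]
  rw [integral_indicator measurableSet_Icc, setIntegral_const, Measure.real, Real.volume_Icc,
    ENNReal.toReal_ofReal (by linarith), smul_eq_mul]
  ring

/-! The likelihood ratio test in terms of the rescaled norm -/

/-- Serves both error probabilities: $F=1$ gives $1-P_F$, and $F$ proportional to $t^{-1}$ changes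
the measure from Gaussian to Cauchy and gives $1-P_D$. -/
lemma integral_lrt {σ γ : ℝ} (hσ : 0 < σ) (hγ : 0 < γ) {n : ℕ} (hn : 1 ≤ n) (η : ℝ) (F : ℝ → ℝ) :
    ∫ y in lrt σ γ n η, F (ratioProfile σ γ n ‖y‖) * gaussianDensity σ n y =
      ∫ x, (if η / ratioProfile σ γ n (σ * √n) ≤ scaledRatio σ γ n x then
        F (ratioProfile σ γ n (σ * √n) * scaledRatio σ γ n x) else 0) * scaledDensity n x := by
  have hc := ratioProfile_pos hσ hγ n (σ * √n)
  have h := integral_mul_gaussianDensity hσ hn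
    (fun r => if η ≤ ratioProfile σ γ n r then F (ratioProfile σ γ n r) else 0)
  have hcx : ∀ x, ratioProfile σ γ n (σ * √n) * scaledRatio σ γ n x =
      ratioProfile σ γ n (σ * unscale n x) := by
    intro x
    rw [scaledRatio]
    field_simp
  simp only [div_le_iff₀' hc, hcx]
  rw [← h, ← integral_indicator (measurableSet_lrt σ γ n η)]
  refine integral_congr_ae (ae_of_all _ fun y => ?_)
  by_cases hy : y ∈ lrt σ γ n η
  · have hy' : η ≤ ratioProfile σ γ n ‖y‖ := hy
    simp only [Set.indicator_of_mem hy, if_pos hy']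
  · have hy' : ¬ η ≤ ratioProfile σ γ n ‖y‖ := hy
    simp only [Set.indicator_of_notMem hy, if_neg hy', zero_mul]

lemma one_sub_falseAlarm_lrt {σ γ : ℝ} (hσ : 0 < σ) (hγ : 0 < γ) {n : ℕ} (hn : 1 ≤ n) (η : ℝ) :
    1 - falseAlarm σ n (lrt σ γ n η) =
      ∫ x, (if η / ratioProfile σ γ n (σ * √n) ≤ scaledRatio σ γ n x then 1 else 0) *
        scaledDensity n x := by
  have := isProbabilityMeasure_gaussianLaw hσ n
  have h := integral_lrt hσ hγ hn η (fun _ => 1)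
  rw [← h, falseAlarm, probReal_compl_eq_one_sub (measurableSet_lrt σ γ n η),
    gaussianLaw_real hσ n (measurableSet_lrt σ γ n η)]
  simp

lemma one_sub_detection_lrt {σ γ : ℝ} (hσ : 0 < σ) (hγ : 0 < γ) {n : ℕ} (hn : 1 ≤ n) (η : ℝ) :
    ratioProfile σ γ n (σ * √n) * (1 - detection γ n (lrt σ γ n η)) =
      ∫ x, (if η / ratioProfile σ γ n (σ * √n) ≤ scaledRatio σ γ n x then
        (scaledRatio σ γ n x)⁻¹ else 0) * scaledDensity n x := by
  have := isProbabilityMeasure_cauchyLaw hγ n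
  have hc := ratioProfile_pos hσ hγ n (σ * √n)
  have h := integral_lrt hσ hγ hn η (fun t => ratioProfile σ γ n (σ * √n) * t⁻¹)
  have e : ∀ x, ratioProfile σ γ n (σ * √n) *
      (ratioProfile σ γ n (σ * √n) * scaledRatio σ γ n x)⁻¹ = (scaledRatio σ γ n x)⁻¹ := by
    intro x
    have := scaledRatio_pos hσ hγ n x
    field_simp
  simp only [e] at h
  rw [← h, detection, probReal_compl_eq_one_sub (measurableSet_lrt σ γ n η),
    cauchyLaw_real hγ n (measurableSet_lrt σ γ n η), sub_sub_cancel, ← integral_const_mul]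
  refine integral_congr_ae (ae_of_all _ fun y => ?_)
  have h1 : gaussianDensity σ n y = gaussianProfile σ n ‖y‖ := rfl
  have h2 := gaussianProfile_pos hσ n ‖y‖
  have h3 := cauchyProfile_pos hγ n ‖y‖
  simp only [h1, cauchyDensity_eq_profile]
  rw [mul_assoc]
  congr 1
  rw [ratioProfile]
  field_simp

/-! ### Limits of the threshold and of the miss probability -/

lemma tendsto_integral_scaledRatio_ge {σ γ p : ℝ} (hσ : 0 < σ) (hγ : 0 < γ) (hp : 0 ≤ p) :
    Tendsto (fun n => ∫ x, (if Real.exp (-(p ^ 2 / 2)) ≤ scaledRatio σ γ n x then (1 : ℝ) else 0) *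
      scaledDensity n x) atTop (nhds ((gaussianReal 0 1).real (Set.Icc (-p) p))) := by
  rw [← integral_ite_exp_mul hp]
  refine tendsto_integral_mul_scaledDensity (K := 1) (fun n => ?_)
    (Eventually.of_forall fun n x => ?_) ?_
  · exact Measurable.ite (measurableSet_le measurable_const (measurable_scaledRatio σ γ n))
      measurable_const measurable_const
  · split_ifs <;> simp
  · filter_upwards [ae_exp_neg_half_sq_ne p] with x hx
    exact tendsto_ite_le (tendsto_scaledRatio hσ hγ x) tendsto_const_nhds hx tendsto_const_nhds

lemma integral_scaledRatio_ge_anti {σ γ : ℝ} {n : ℕ} (hn : 1 ≤ n) {s t : ℝ} (hst : s ≤ t) :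
    ∫ x, (if t ≤ scaledRatio σ γ n x then (1 : ℝ) else 0) * scaledDensity n x ≤
      ∫ x, (if s ≤ scaledRatio σ γ n x then (1 : ℝ) else 0) * scaledDensity n x := by
  have hi : ∀ t : ℝ, Integrable fun x =>
      (if t ≤ scaledRatio σ γ n x then (1 : ℝ) else 0) * scaledDensity n x := by
    intro t
    refine (integrable_scaledDensity hn).bdd_mul (c := 1) ?_ (ae_of_all _ fun x => ?_)
    · exact (Measurable.ite (measurableSet_le measurable_const (measurable_scaledRatio σ γ n))
        measurable_const measurable_const).aestronglyMeasurable
    · split_ifs <;> simp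
  refine integral_mono (hi t) (hi s) fun x => ?_
  refine mul_le_mul_of_nonneg_right ?_ (scaledDensity_nonneg hn x)
  by_cases h1 : t ≤ scaledRatio σ γ n x
  · rw [if_pos h1, if_pos (hst.trans h1)]
  · rw [if_neg h1]
    split_ifs <;> norm_num

/-- Thresholds with a fixed false alarm probability converge after normalization. -/
lemma tendsto_threshold {σ γ ε q : ℝ} (hσ : 0 < σ) (hγ : 0 < γ) (hq : 0 < q)
    (hqε : gaussianQ q = ε / 2) {η : ℕ → ℝ}
    (hη : ∀ᶠ n in atTop, 0 < η n ∧ falseAlarm σ n (lrt σ γ n (η n)) = ε) :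
    Tendsto (fun n : ℕ => η n / ratioProfile σ γ n (σ * √n)) atTop
      (nhds (Real.exp (-(q ^ 2 / 2)))) := by
  have hcont : Continuous fun p : ℝ => Real.exp (-(p ^ 2 / 2)) := by fun_prop
  have hIcc := gaussianReal_real_Icc hq.le
  rw [hqε] at hIcc
  refine tendsto_order.2 ⟨fun a ha => ?_, fun a ha => ?_⟩
  -- Take $p>q$ with $e^{-p^2/2}$ still above $a$. A normalised threshold at most $a$ would accept
  -- at least as often as $e^{-p^2/2}$ does, whose limiting probability exceeds $1-\varepsilon$. The
  -- other side is symmetric, with $p<q$.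
  · have h1 : ∀ᶠ p in nhdsWithin q (Set.Ioi q), a < Real.exp (-(p ^ 2 / 2)) :=
      (hcont.continuousAt.continuousWithinAt.tendsto).eventually_const_lt ha
    obtain ⟨p, hpa, hpq⟩ := (h1.and self_mem_nhdsWithin).exists
    have hpq : q < p := hpq
    have hlt := gaussianReal_real_Icc_lt hq.le hpq
    filter_upwards [hη, eventually_ge_atTop 1, (tendsto_integral_scaledRatio_ge hσ hγ
      (hq.trans hpq).le).eventually_const_lt hlt] with n h1 hn h2
    by_contra! hle
    have h3 := integral_scaledRatio_ge_anti (σ := σ) (γ := γ) hn (hle.trans hpa.le)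
    rw [← one_sub_falseAlarm_lrt hσ hγ hn, h1.2] at h3
    linarith
  · have h1 : ∀ᶠ p in nhdsWithin q (Set.Iio q), Real.exp (-(p ^ 2 / 2)) < a :=
      (hcont.continuousAt.continuousWithinAt.tendsto).eventually_lt_const ha
    have h0 : ∀ᶠ p in nhdsWithin q (Set.Iio q), 0 < p :=
      nhdsWithin_le_nhds (lt_mem_nhds hq)
    obtain ⟨p, ⟨hpa, hp0⟩, hpq⟩ := ((h1.and h0).and self_mem_nhdsWithin).exists
    have hpq : p < q := hpq
    have hlt := gaussianReal_real_Icc_lt hp0.le hpq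
    filter_upwards [hη, eventually_ge_atTop 1, (tendsto_integral_scaledRatio_ge hσ hγ
      hp0.le).eventually_lt_const hlt] with n h1 hn h2
    by_contra! hle
    have h3 := integral_scaledRatio_ge_anti (σ := σ) (γ := γ) hn (hpa.le.trans hle)
    rw [← one_sub_falseAlarm_lrt hσ hγ hn, h1.2] at h3
    linarith

lemma tendsto_ratioProfile_mul_miss {σ γ ε q : ℝ} (hσ : 0 < σ) (hγ : 0 < γ) (hq : 0 < q)
    (hqε : gaussianQ q = ε / 2) {η : ℕ → ℝ}
    (hη : ∀ᶠ n in atTop, 0 < η n ∧ falseAlarm σ n (lrt σ γ n (η n)) = ε) :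
    Tendsto (fun n : ℕ => ratioProfile σ γ n (σ * √n) * (1 - detection γ n (lrt σ γ n (η n))))
      atTop (nhds (2 * q / √(2 * Real.pi))) := by
  have hθ := tendsto_threshold hσ hγ hq hqε hη
  set τ := Real.exp (-(q ^ 2 / 2)) with hτ
  have hτ0 : 0 < τ := Real.exp_pos _
  rw [← integral_ite_exp_inv_mul hq.le]
  have key : Tendsto (fun n : ℕ => ∫ x,
      (if η n / ratioProfile σ γ n (σ * √n) ≤ scaledRatio σ γ n x then
        (scaledRatio σ γ n x)⁻¹ else 0) * scaledDensity n x) atTop (nhds (∫ x,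
      (if Real.exp (-(q ^ 2 / 2)) ≤ Real.exp (-(x ^ 2 / 2)) then
        (Real.exp (-(x ^ 2 / 2)))⁻¹ else 0) * gaussianPDFReal 0 1 x)) := by
    -- On the acceptance region the ratio is at least the normalised threshold, eventually above
    -- $\tau/2$, so its reciprocal is bounded.
    refine tendsto_integral_mul_scaledDensity (K := (τ / 2)⁻¹) (fun n => ?_) ?_ ?_
    · exact Measurable.ite (measurableSet_le measurable_const (measurable_scaledRatio σ γ n))
        (measurable_scaledRatio σ γ n).inv measurable_const
    · filter_upwards [hθ.eventually_const_lt (half_lt_self hτ0)] with n hn x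
      split_ifs with h
      · have := scaledRatio_pos hσ hγ n x
        rw [abs_of_pos (inv_pos.2 this)]
        exact inv_anti₀ (by positivity) (hn.le.trans h)
      · rw [abs_zero]
        positivity
    · filter_upwards [ae_exp_neg_half_sq_ne q] with x hx
      have hx' := tendsto_scaledRatio hσ hγ x
      exact tendsto_ite_le hx' hθ hx (hx'.inv₀ (Real.exp_pos _).ne')
  refine key.congr' ?_
  filter_upwards [eventually_ge_atTop 1] with n hn
  exact (one_sub_detection_lrt hσ hγ hn (η n)).symm

lemma isEquivalent_miss {σ γ ξ ε : ℝ} (hσ : 0 < σ) (hγ : 0 < γ) (hξ : ξ = √2 * (σ / γ))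
    (hε₀ : 0 < ε) (hε₁ : ε < 1) {η : ℕ → ℝ}
    (hη : ∀ᶠ n in atTop, 0 < η n ∧ falseAlarm σ n (lrt σ γ n (η n)) = ε) :
    Asymptotics.IsEquivalent atTop (fun n : ℕ => 1 - detection γ n (lrt σ γ n (η n)))
      (fun n : ℕ => √(2 / Real.pi) * (2 / ξ) * Real.exp (-(1 / ξ ^ 2)) *
        gaussianQInv (ε / 2) * (1 / √n)) := by
  have hpi := Real.pi_pos
  have hqε := gaussianQ_gaussianQInv (p := ε / 2) (by linarith) (by linarith)
  set q := gaussianQInv (ε / 2) with hq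
  have hq0 : 0 < q := pos_of_gaussianQ_lt (by rw [hqε]; linarith)
  have hξ0 : 0 < ξ := by rw [hξ]; positivity
  have hs2 : √(2 : ℝ) ^ 2 = 2 := Real.sq_sqrt (by norm_num)
  have hexp : γ ^ 2 / (2 * σ ^ 2) = 1 / ξ ^ 2 := by
    rw [hξ, mul_pow, hs2]
    field_simp
  have hσγ : σ / γ / √2 = ξ / 2 := by
    rw [hξ]
    field_simp
    rw [hs2]
  have h1 := tendsto_ratioProfile_mul_miss hσ hγ hq0 hqε hη
  have h2 := tendsto_ratioProfile_div_sqrt hσ hγ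
  rw [hexp, hσγ] at h2
  have hE := Real.exp_pos (1 / ξ ^ 2)
  -- In the quotient of the two limits the ratio at $\sigma\sqrt n$ cancels and $\sqrt n\,(1-P_D)$
  -- remains.
  have h3 := (h1.div h2 (by positivity)).div_const
    (√(2 / Real.pi) * (2 / ξ) * Real.exp (-(1 / ξ ^ 2)) * q)
  have hlim : 2 * q / √(2 * Real.pi) / (ξ / 2 * Real.exp (1 / ξ ^ 2)) /
      (√(2 / Real.pi) * (2 / ξ) * Real.exp (-(1 / ξ ^ 2)) * q) = 1 := by
    rw [Real.exp_neg, Real.sqrt_mul (by norm_num), Real.sqrt_div (by norm_num)]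
    have : 0 < √Real.pi := by positivity
    field_simp
    rw [hs2]
  rw [hlim] at h3
  refine Asymptotics.isEquivalent_of_tendsto_one (h3.congr' ?_)
  filter_upwards [eventually_ge_atTop 1] with n hn
  have hn0 : 0 < (n : ℝ) := by exact_mod_cast hn
  have hsn : 0 < √(n : ℝ) := by positivity
  have hc := ratioProfile_pos hσ hγ n (σ * √n)
  simp only [Pi.div_apply]
  field_simp

end GaussCauchy

end

theorem theorem2 (σ γ ξ ε : ℝ) (hσ : 0 < σ) (hγ : 0 < γ)
    (hξ : ξ = Real.sqrt 2 * (σ / γ)) (hε₀ : 0 < ε) (hε₁ : ε < 1) :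
    -- Case 1
    ((∀ n : ℕ, 1 ≤ n → ∃ η : ℝ, 0 < η ∧
        GaussCauchy.falseAlarm σ n (GaussCauchy.lrt σ γ n η) = ε) ∧
      (∀ n : ℕ, 1 ≤ n → ∀ η : ℝ, 0 < η →
        GaussCauchy.falseAlarm σ n (GaussCauchy.lrt σ γ n η) = ε →
        GaussCauchy.OptimalGivenFalseAlarm σ γ n ε (GaussCauchy.lrt σ γ n η)) ∧
      (∀ η : ℕ → ℝ,
        (∀ᶠ n in atTop, 0 < η n ∧
          GaussCauchy.falseAlarm σ n (GaussCauchy.lrt σ γ n (η n)) = ε) →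
        Asymptotics.IsEquivalent atTop
          (fun n : ℕ => 1 - GaussCauchy.detection γ n (GaussCauchy.lrt σ γ n (η n)))
          (fun n : ℕ => Real.sqrt (2 / Real.pi) * (2 / ξ) * Real.exp (-(1 / ξ ^ 2)) *
            GaussCauchy.gaussianQInv (ε / 2) * (1 / Real.sqrt n)))) ∧
    -- Case 2
    ((∀ n : ℕ, 1 ≤ n → ∃ η : ℝ, 0 < η ∧
        1 - GaussCauchy.detection γ n (GaussCauchy.lrt σ γ n η) = ε) ∧
      (∀ n : ℕ, 1 ≤ n → ∀ η : ℝ, 0 < η →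
        1 - GaussCauchy.detection γ n (GaussCauchy.lrt σ γ n η) = ε →
        GaussCauchy.OptimalGivenMiss σ γ n ε (GaussCauchy.lrt σ γ n η)) ∧
      (∃ κ₁ κ₂ κ₃ κ₄ : ℝ, 0 < κ₁ ∧ 0 < κ₂ ∧ 0 < κ₃ ∧ 0 < κ₄ ∧
        ∀ n : ℕ, 1 ≤ n → ∀ η : ℝ, 0 < η →
          1 - GaussCauchy.detection γ n (GaussCauchy.lrt σ γ n η) = ε →
          κ₁ * Real.exp (-κ₂ * n) / Real.sqrt n
              ≤ GaussCauchy.falseAlarm σ n (GaussCauchy.lrt σ γ n η) ∧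
            GaussCauchy.falseAlarm σ n (GaussCauchy.lrt σ γ n η)
              ≤ κ₃ * Real.exp (-κ₄ * n) / Real.sqrt n)) := by
  obtain ⟨κ₁, κ₂, h₁, h₂, hlow⟩ := GaussCauchy.exists_le_falseAlarm hσ hγ hε₁
  obtain ⟨κ₃, κ₄, h₃, h₄, hup⟩ := GaussCauchy.exists_falseAlarm_le hσ hγ hε₀
  exact ⟨⟨fun n hn => GaussCauchy.exists_falseAlarm_eq hσ hγ hn hε₀ hε₁,
      fun n _ η hη h => GaussCauchy.optimalGivenFalseAlarm_lrt hσ hγ hη n h,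
      fun η hη => GaussCauchy.isEquivalent_miss hσ hγ hξ hε₀ hε₁ hη⟩,
    ⟨fun n hn => GaussCauchy.exists_miss_eq hσ hγ hn hε₀ hε₁,
      fun n _ η hη h => GaussCauchy.optimalGivenMiss_lrt hσ hγ hη n h,
      κ₁, κ₂, κ₃, κ₄, h₁, h₂, h₃, h₄, fun n hn η hη h =>
        ⟨hlow n hn _ (GaussCauchy.measurableSet_lrt σ γ n η) h, hup n hn η hη h⟩⟩⟩
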